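/- Conventions. All graphs are finite and simple. A graph is \emph{co-edge-regular} if it is regular and there is $\mu$ such that any two distinct non-adjacent vertices have exactly $\mu$ common neighbours; its \emph{level} is the number of distinct values taken by the number of common neighbours of $x$ and $y$ as $\{x,y\}$ ranges over the edges. Two graphs are \emph{cospectral} if their adjacency matrices have the same eigenvalues with the same multiplicities. The \emph{$m$-clique extension} of a graph $G$ has vertex set $V(G)\times[m]$, with distinct $(x,a),(y,b)$ adjacent iff $x=y$ or $x\sim y$ in $G$. An \emph{orthogonal array} $OA(N,t)$ is a $t\times N^2$ array with entries in $[N]$ such that for any two distinct rows $r,r'$ the $N^2$ pairs $(r(\ell),r'(\ell))$ are distinct. The \emph{Latin Square graph} $LS_t(N)$ with respect to an $OA(N,t)$ has the columns as vertices, two distinct columns being adjacent iff they agree in some row. A $GOA(n,q,t)$ is a $qt\times n^2$ array with entries in $[n]$ whose rows are divided into $t$ groups of $q$ rows $r^i_1,\dots,r^i_q$ $(1\le i\le t)$ (repetitions within a group allowed) such that for any two rows $r,r'$ in different groups the $n^2$ pairs $(r(\ell),r'(\ell))$ are distinct. Let $q$ be a prime power. Take $q+1$ parallel classes $\{P^i_1,\dots,P^i_q\}$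 $(1\le i\le q+1)$, each consisting of $q$ mutually disjoint affine planes in $\mathbb F_q^3$, such that planes from two different classes meet in exactly $q$ points and planes from three different classes meet in exactly one point, and take a $GOA(n,q,q+1)$ with rows $r^i_j$. The \emph{twisted Latin Square graph} $TLS(q,n)$ built from these data has vertex set $\mathbb F_q^3\times[n^2]$; distinct vertices $(x,i)$ and $(y,j)$ are adjacent iff $i=j$ or there are $p\in[q+1]$, $\ell\in[q]$ with $x,y\in P^p_\ell$ and $r^p_\ell(i)=r^p_\ell(j)$. \textbf{Theorem.} Let $q$ be a prime power and let $s\ge 2$ be a multiple of $q$. There are infinitely many integers $n\ge 2$ for which both a twisted Latin Square graph $TLS(q,n)$ and a Latin Square graph $LS_{q+1}(qn)$ exist. Moreover, for every $n\ge2$ and every twisted Latin Square graph $TLS(q,n)$, the $(s/q)$-clique extension of $TLS(q,n)$ is a co-edge-regular graph of level at least $3$; its level is exactly $3$ if $s=q$ and exactly $4$ if $s\ne q$; it is cospectral with the $s$-clique extension of each Latin Square graph $LS_{q+1}(qn)$; and it has exactly four distinct eigenvalues. -/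

import Mathlib

/-! ### Spectra, co-edge-regularity, level, clique extensions -/

/-- The spectrum of a finite graph: the eigenvalues of its (real symmetric) adjacency matrix,
counted with multiplicity. -/
noncomputable def graphSpectrum {V : Type*} [Fintype V] (G : SimpleGraph V) : Multiset ℝ := by
  classical exact (G.adjMatrix ℝ).charpoly.roots

/-- Two finite graphs are cospectral if they have the same spectrum. -/
def Cospectral {V W : Type*} [Fintype V] [Fintype W] (G : SimpleGraph V) (H : SimpleGraph W) :
    Prop :=
  graphSpectrum G = graphSpectrum H

/-- The number of distinct eigenvalues of a finite graph. -/
noncomputable def numDistinctEigenvalues {V : Type*} [Fintype V] (G : SimpleGraph V) : ℕ := by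
  classical exact (graphSpectrum G).toFinset.card

/-- The number of common neighbours of two vertices. -/
noncomputable def numCommonNeighbors {V : Type*} (G : SimpleGraph V) (x y : V) : ℕ :=
  (G.commonNeighbors x y).ncard

/-- A finite graph is co-edge-regular if it is regular and there is `μ` such that any two distinct
non-adjacent vertices have exactly `μ` common neighbours. -/
def IsCoEdgeRegular {V : Type*} (G : SimpleGraph V) : Prop :=
  (∃ k : ℕ, ∀ x : V, (G.neighborSet x).ncard = k) ∧
  ∃ μ : ℕ, ∀ x y : V, x ≠ y → ¬ G.Adj x y → numCommonNeighbors G x y = μ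

/-- The level of a (co-edge-regular) finite graph: the number of distinct values taken by the number
of common neighbours of two adjacent vertices. -/
noncomputable def level {V : Type*} (G : SimpleGraph V) : ℕ :=
  {l : ℕ | ∃ x y : V, G.Adj x y ∧ numCommonNeighbors G x y = l}.ncard

/-- The `s`-clique extension of `G`: every vertex is replaced by a clique with `s` vertices. -/
def cliqueExtension {V : Type*} (s : ℕ) (G : SimpleGraph V) : SimpleGraph (V × Fin s) where
  Adj u v := u ≠ v ∧ (u.1 = v.1 ∨ G.Adj u.1 v.1)
  symm := ⟨fun _ _ h => ⟨h.1.symm, h.2.imp Eq.symm fun e => e.symm⟩⟩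
  loopless := ⟨fun _ h => h.1 rfl⟩

/-! ### Orthogonal arrays and Latin Square graphs -/

/-- An orthogonal array `OA(n, t)`: a `t × n²` array with entries in `[n]` such that for any two
rows all `n²` columns give distinct pairs of entries. -/
structure OrthogonalArray (n t : ℕ) where
  row : Fin t → Fin (n ^ 2) → Fin n
  orthogonal : ∀ i j : Fin t, i ≠ j →
    (Finset.univ.image fun l : Fin (n ^ 2) => (row i l, row j l)).card = n ^ 2

/-- The Latin Square graph `LS_t(n)` with respect to an `OA(n, t)`: the vertices are the columns, and
two distinct columns are adjacent if they agree in some row. -/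
def OrthogonalArray.latinSquareGraph {n t : ℕ} (O : OrthogonalArray n t) :
    SimpleGraph (Fin (n ^ 2)) where
  Adj c d := c ≠ d ∧ ∃ l : Fin t, O.row l c = O.row l d
  symm := ⟨fun _ _ h => ⟨h.1.symm, h.2.imp fun _ => Eq.symm⟩⟩
  loopless := ⟨fun _ h => h.1 rfl⟩

/-- A group-divisible orthogonal array `GOA(n, s, t)`: an `st × n²` array with entries in `[n]` whose
rows are divided into `t` groups of `s` rows, such that for any two rows from different groups all
`n²` columns give distinct pairs of entries. Rows in a group may be repeated; `row i j` is the
`j`-th row of the `i`-th group. -/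
structure GroupDivisibleOA (n s t : ℕ) where
  row : Fin t → Fin s → Fin (n ^ 2) → Fin n
  orthogonal : ∀ i i' : Fin t, i ≠ i' → ∀ j j' : Fin s,
    (Finset.univ.image fun l : Fin (n ^ 2) => (row i j l, row i' j' l)).card = n ^ 2

/-! ### Parallel classes of planes and twisted Latin Square graphs -/

/-- `q + 1` parallel classes, each consisting of `q` mutually disjoint affine planes in `F³`, such
that planes from two different classes meet in `q` points and planes from three different classes
meet in one point. `plane i j` is the `j`-th plane of the `i`-th class. -/
structure ParallelClasses (q : ℕ) (F : Type) [Field F] where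
  plane : Fin (q + 1) → Fin q → AffineSubspace F (Fin 3 → F)
  finrank_direction : ∀ i j, Module.finrank F (plane i j).direction = 2
  disjoint : ∀ i j j', j ≠ j' →
    Disjoint (plane i j : Set (Fin 3 → F)) (plane i j' : Set (Fin 3 → F))
  ncard_inter : ∀ i i', i ≠ i' → ∀ j j',
    ((plane i j : Set (Fin 3 → F)) ∩ plane i' j').ncard = q
  ncard_inter_inter : ∀ h i k, h < i → i < k → ∀ a b c,
    ((plane h a : Set (Fin 3 → F)) ∩ plane i b ∩ plane k c).ncard = 1

/-- The data from which a twisted Latin Square graph `TLS(q, n)` is built: the field `F` with `q`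
elements, `q + 1` parallel classes of planes in `F³`, and a `GOA(n, q, q + 1)`. -/
structure TwistedLatinSquareDatum (q n : ℕ) where
  F : Type
  [field : Field F]
  [fintype : Fintype F]
  card_eq : Fintype.card F = q
  classes : ParallelClasses q F
  array : GroupDivisibleOA n q (q + 1)

attribute [instance] TwistedLatinSquareDatum.field TwistedLatinSquareDatum.fintype

/-- The vertex set `F³ × [n²]` of a twisted Latin Square graph. -/
abbrev TwistedLatinSquareDatum.Vertex {q n : ℕ} (T : TwistedLatinSquareDatum q n) : Type :=
  (Fin 3 → T.F) × Fin (n ^ 2)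

/-- The twisted Latin Square graph `TLS(q, n)`: two distinct vertices `(x, i)` and `(y, j)` are
adjacent if `i = j`, or if some plane of the classes contains both `x` and `y` and the corresponding
row of the array has equal entries in columns `i` and `j`. -/
def TwistedLatinSquareDatum.graph {q n : ℕ} (T : TwistedLatinSquareDatum q n) :
    SimpleGraph T.Vertex where
  Adj u v := u ≠ v ∧ (u.2 = v.2 ∨ ∃ (p : Fin (q + 1)) (l : Fin q),
    u.1 ∈ T.classes.plane p l ∧ v.1 ∈ T.classes.plane p l ∧
      T.array.row p l u.2 = T.array.row p l v.2)
  symm := ⟨fun _ _ h => ⟨h.1.symm, h.2.imp Eq.symm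
    fun ⟨p, l, hu, hv, e⟩ => ⟨p, l, hv, hu, e.symm⟩⟩⟩
  loopless := ⟨fun _ h => h.1 rfl⟩

/-- The vertex set of a twisted Latin Square graph is finite. -/
noncomputable instance TwistedLatinSquareDatum.fintypeVertex {q n : ℕ}
    (T : TwistedLatinSquareDatum q n) : Fintype T.Vertex := by
  classical infer_instance

/-! Both graphs are governed by one small matrix algebra. Put X = A + I, let K be the all-ones
matrix, and let T count, for two vertices, the parallelism relations they share. For LS_{q+1}(qn) a
relation is agreement in a row. For TLS(q,n) it is lying in a common plane of a given class together
with agreement in the row of that plane. In both cases T² and TK follow from counting how fibres of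
different relations meet.

In the Latin square case X = T - qI. In the twisted case X = T + C, where C lives on pairs in the
same column and replaces their agreement number by 1. The planes are numerous enough that CT = -q²T,
CK = -q²K and C² = -q²C. Either way X² = XT - aX, where XT is a combination of T and K and XK a
multiple of K; the coefficients depend only on a, q, n, with a = q and a = q² respectively
(`CliqueAlgebra`). An m-clique extension multiplies a by m, so the (s/q)-extension of TLS and the
s-extension of LS have equal parameters and equal traces of X, T, K.

Traces of all polynomials in X are then determined, which gives cospectrality. The relations also
make X annihilated by a quartic with distinct roots, each of which is attained.

Since A² = X² - 2X + I, a number of common neighbours depends only on adjacency, equality and the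
agreement number t. Non-adjacent pairs have t = 0, giving co-edge-regularity, while on edges the
count is strictly increasing in t. Edges realise t = 0, 1, 2, and also t = q + 1 between twins when
the extension is proper, whence level 3 or 4.

For existence, lines over finite fields give the arrays, and planes dual to a conic give the
parallel classes. -/

/-! ### Spectra of real symmetric matrices through traces -/

section SpectralTools

open Polynomial

variable {V W : Type*} [Fintype V] [Fintype W] [DecidableEq V] [DecidableEq W]

/-- The trace of a polynomial in a real symmetric matrix is the sum of the values of the polynomial
at the eigenvalues. -/
theorem Matrix.IsHermitian.trace_aeval {A : Matrix V V ℝ} (hA : A.IsHermitian) (p : ℝ[X]) :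
    (aeval A p).trace = ∑ i, p.eval (hA.eigenvalues i) := by
  have hpow : ∀ k : ℕ, (A ^ k).trace = ∑ i, hA.eigenvalues i ^ k := by
    intro k
    conv_lhs => rw [hA.spectral_theorem]
    rw [← map_pow, Unitary.conjStarAlgAut_apply, Matrix.trace_mul_comm, ← mul_assoc]
    simp [Matrix.diagonal_pow, Matrix.trace_diagonal]
  induction p using Polynomial.induction_on' with
  | add p r hp hr => simp [Matrix.trace_add, hp, hr, Finset.sum_add_distrib]
  | monomial k c =>
    rw [aeval_monomial, ← Algebra.smul_def, Matrix.trace_smul, hpow, smul_eq_mul, Finset.mul_sum]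
    simp

/-- Real symmetric matrices on which all polynomials have the same trace have the same
eigenvalues. -/
theorem Matrix.IsHermitian.roots_charpoly_eq_of_trace_aeval_eq
    {A : Matrix V V ℝ} {B : Matrix W W ℝ} (hA : A.IsHermitian) (hB : B.IsHermitian)
    (h : ∀ p : ℝ[X], (aeval A p).trace = (aeval B p).trace) :
    A.charpoly.roots = B.charpoly.roots := by
  classical
  rw [hA.roots_charpoly_eq_eigenvalues, hB.roots_charpoly_eq_eigenvalues]
  ext θ
  -- The Lagrange polynomial that is 1 at θ and 0 at every other eigenvalue of either matrix has
  -- trace equal to the multiplicity of θ. Inserting θ into the nodes covers the case where it is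
  -- not an eigenvalue.
  let Z : Finset ℝ := insert θ
    (Finset.univ.image hA.eigenvalues ∪ Finset.univ.image hB.eigenvalues)
  have heval : ∀ x ∈ Z, (Lagrange.basis Z id θ).eval x = if θ = x then 1 else 0 := by
    intro x hx
    split_ifs with hθ
    · subst hθ
      exact Lagrange.eval_basis_self (v := id) (Set.injOn_id _) hx
    · exact Lagrange.eval_basis_of_ne (v := id) hθ hx
  have key := h (Lagrange.basis Z id θ)
  rw [hA.trace_aeval, hB.trace_aeval,
    Finset.sum_congr rfl fun i _ => heval _ (by simp [Z]),
    Finset.sum_congr rfl fun i _ => heval _ (by simp [Z])] at key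
  simp only [Multiset.count_map, Finset.sum_boole] at key ⊢
  exact_mod_cast key

/-- A nonzero matrix annihilated by `A - θ` exhibits `θ` as an eigenvalue of `A`. -/
theorem Matrix.mem_spectrum_of_mul_eq_smul {A Y : Matrix V V ℝ} {θ : ℝ} (hY : Y ≠ 0)
    (h : A * Y = θ • Y) : θ ∈ spectrum ℝ A := by
  rw [spectrum.mem_iff]
  intro hu
  apply hY
  have h0 : (algebraMap ℝ (Matrix V V ℝ) θ - A) * Y = 0 := by
    rw [sub_mul, h, ← Algebra.smul_def, sub_self]
  exact (hu.mul_right_eq_zero).1 h0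

end SpectralTools

/-! ### The algebra spanned by X, T, K and its spectrum -/

/-- The relations satisfied by `X = A + I`, the sum `T` of the parallelism relations and the all-ones
matrix `K` of the clique extensions of Latin Square graphs and of twisted Latin Square graphs. -/
structure CliqueAlgebra {V : Type*} [Fintype V] (X T K : Matrix V V ℝ) (a q n N : ℝ) : Prop where
  mul_self : X * X = (-a) • X + (a * (n - 1)) • T + (a * (q + 1)) • K
  mul_T : X * T = (a * (n - 1)) • T + (a * (q + 1)) • K
  mul_K : X * K = (a * (q * n + n - 1)) • K
  trace_X : X.trace = N
  trace_T : T.trace = (q + 1) * N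
  trace_K : K.trace = N

namespace CliqueAlgebra

open Polynomial

variable {V W : Type*} [Fintype V] [Fintype W] [DecidableEq V] [DecidableEq W]
  {X T K : Matrix V V ℝ} {X' T' K' : Matrix W W ℝ} {a q n N : ℝ}

/-- Left multiplication by X preserves the span of X, T, K with coefficients depending only on a, q,
n. The three traces are carried together because the relation for X involves T and K, and that for T
involves K. -/
theorem trace_pow_mul (h : CliqueAlgebra X T K a q n N) (h' : CliqueAlgebra X' T' K' a q n N)
    (k : ℕ) :
    (X ^ k * X).trace = (X' ^ k * X').trace ∧ (X ^ k * T).trace = (X' ^ k * T').trace ∧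
      (X ^ k * K).trace = (X' ^ k * K').trace := by
  induction k with
  | zero => simp [h.trace_X, h'.trace_X, h.trace_T, h'.trace_T, h.trace_K, h'.trace_K]
  | succ k ih =>
    obtain ⟨h1, h2, h3⟩ := ih
    simp only [pow_succ, mul_assoc, h.mul_self, h'.mul_self, h.mul_T, h'.mul_T, h.mul_K, h'.mul_K,
      mul_add, Matrix.mul_smul, Matrix.trace_add, Matrix.trace_smul, h1, h2, h3, and_self]

theorem trace_aeval_eq (h : CliqueAlgebra X T K a q n N) (h' : CliqueAlgebra X' T' K' a q n N)
    (hcard : Fintype.card V = Fintype.card W) (p : ℝ[X]) :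
    (aeval X p).trace = (aeval X' p).trace := by
  induction p using Polynomial.induction_on' with
  | add p r hp hr => simp [Matrix.trace_add, hp, hr]
  | monomial k c =>
    rw [aeval_monomial, ← Algebra.smul_def, Matrix.trace_smul, aeval_monomial, ← Algebra.smul_def,
      Matrix.trace_smul]
    cases k with
    | zero => simp [hcard]
    | succ k => rw [pow_succ, pow_succ, (h.trace_pow_mul h' k).1]

theorem spectrum_eq (h : CliqueAlgebra X T K a q n N) (hq : 2 ≤ q) (hn : 2 ≤ n) (ha : q < a)
    (hN : 0 < N) (hcard : Fintype.card V = N) :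
    spectrum ℝ X = {0, -a, a * (n - 1), a * (q * n + n - 1)} := by
  have ha0 : 0 < a := by linarith
  have hqn : 4 ≤ q * n := by nlinarith
  have hκ : 0 < q * n + n - 1 := by linarith
  apply Set.Subset.antisymm
  · intro θ hθ
    -- The factors act in turn: (X + a)X lies in the span of T and K, the next factor leaves a
    -- multiple of K, and the last kills K.
    have hzero : aeval X ((Polynomial.X - C (a * (q * n + n - 1))) *
        (Polynomial.X - C (a * (n - 1))) *
        ((Polynomial.X + C a) * Polynomial.X)) = 0 := by
      have hadd : ∀ c : ℝ, aeval X (Polynomial.X + C c) = X + c • (1 : Matrix V V ℝ) := fun c => by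
        rw [map_add, aeval_X, aeval_C, Algebra.algebraMap_eq_smul_one]
      have hsub : ∀ c : ℝ, aeval X (Polynomial.X - C c) = X - c • (1 : Matrix V V ℝ) := fun c => by
        rw [map_sub, aeval_X, aeval_C, Algebra.algebraMap_eq_smul_one]
      have e1 : (X + a • (1 : Matrix V V ℝ)) * X = (a * (n - 1)) • T + (a * (q + 1)) • K := by
        rw [add_mul, h.mul_self, smul_mul_assoc, one_mul]; module
      have e2 : (X - (a * (n - 1)) • (1 : Matrix V V ℝ)) * ((a * (n - 1)) • T + (a * (q + 1)) • K)
          = (a * (q + 1) * (a * (q * n + n - 1))) • K := by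
        rw [sub_mul, mul_add, smul_mul_assoc, one_mul, mul_smul_comm, mul_smul_comm, h.mul_T,
          h.mul_K]
        module
      rw [map_mul (aeval X), map_mul (aeval X), map_mul (aeval X), hsub, hsub, hadd, aeval_X,
        mul_assoc, e1, e2, mul_smul_comm, sub_mul, h.mul_K, smul_mul_assoc, one_mul, sub_self,
        smul_zero]
    have hmem := spectrum.subset_polynomial_aeval X
      ((Polynomial.X - C (a * (q * n + n - 1))) * (Polynomial.X - C (a * (n - 1))) *
        ((Polynomial.X + C a) * Polynomial.X)) ⟨θ, hθ, rfl⟩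
    rw [hzero] at hmem
    have : Nonempty V := by
      by_contra hV
      rw [not_nonempty_iff] at hV
      simp at hcard
      linarith
    have h0 := hmem
    rw [spectrum.zero_eq, Set.mem_singleton_iff] at h0
    simp only [eval_mul, eval_sub, eval_add, eval_X, eval_C, mul_eq_zero] at h0
    simp only [Set.mem_insert_iff, Set.mem_singleton_iff]
    rcases h0 with (h0 | h0) | h0 | h0
    · right; right; right; linarith
    · right; right; left; linarith
    · right; left; linarith
    · left; exact h0
  · have htrace1 : (1 : Matrix V V ℝ).trace = N := by rw [Matrix.trace_one, hcard]
    intro θ hθ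
    simp only [Set.mem_insert_iff, Set.mem_singleton_iff] at hθ
    have hne : ∀ {Y : Matrix V V ℝ} (c : ℝ), Y.trace = c * N → c ≠ 0 → Y ≠ 0 := by
      rintro Y c hY hc rfl
      rw [Matrix.trace_zero] at hY
      exact mul_ne_zero hc hN.ne' hY.symm
    -- Write b = a(n-1) and κ = a(qn+n-1). The witnesses are the complementary products
    -- (X+a)(X-b)(X-κ), X(X-b)(X-κ), (X-κ)T divided by a, and K, expanded by the relations; a
    -- nonzero trace shows that each is nonzero. The factor a - q in the first trace is where q < a
    -- enters.
    rcases hθ with rfl | rfl | rfl | rfl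
    · refine Matrix.mem_spectrum_of_mul_eq_smul
        (Y := ((-a) * (-(a * (n - 1)) - a * (q * n + n - 1)) + (-(a * (a * (n - 1))) -
            a * (a * (q * n + n - 1)) + a * (n - 1) * (a * (q * n + n - 1)))) • X +
          (a * (a * (n - 1)) * (a * (q * n + n - 1))) • (1 : Matrix V V ℝ) +
          ((a * (n - 1)) * (-(a * (n - 1)) - a * (q * n + n - 1)) + (a * (n - 1)) ^ 2) • T +
          ((a * (q + 1)) * (-(a * (n - 1)) - a * (q * n + n - 1)) +
            (a * (q + 1)) * (a * (n - 1) + a * (q * n + n - 1))) • K)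
        (hne (a * (q * n + n - 1) * a * (n - 1) * (a - q)) ?_ ?_) ?_
      · simp only [Matrix.trace_add, Matrix.trace_smul, h.trace_X, h.trace_T, h.trace_K, htrace1,
          smul_eq_mul]
        ring
      · have h1 : 0 < n - 1 := by linarith
        have h2 : 0 < a - q := by linarith
        positivity
      · simp only [mul_add, mul_smul_comm, h.mul_self, h.mul_T, h.mul_K, mul_one]
        module
    · refine Matrix.mem_spectrum_of_mul_eq_smul
        (Y := (a * n * (a * n * (q + 1))) • X -
          (a * n) • ((a * (n - 1)) • T + (a * (q + 1)) • K) +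
          (a * (a * (n - 1))) • ((-(q * n)) • T + (q + 1) • K))
        (hne (a ^ 2 * (n - 1) * (q + 1) * (1 - q * n)) ?_ ?_) ?_
      · simp only [Matrix.trace_add, Matrix.trace_sub, Matrix.trace_smul, h.trace_X, h.trace_T,
          h.trace_K, smul_eq_mul]
        ring
      · have h1 : n - 1 ≠ 0 := by intro h; linarith
        have h2 : q + 1 ≠ 0 := by intro h; linarith
        have h3 : 1 - q * n ≠ 0 := by intro h; linarith
        positivity
      · simp only [mul_add, mul_sub, mul_smul_comm, h.mul_self, h.mul_T, h.mul_K]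
        module
    · refine Matrix.mem_spectrum_of_mul_eq_smul (Y := (-(q * n)) • T + (q + 1) • K)
        (hne ((q + 1) * (1 - q * n)) ?_ ?_) ?_
      · simp only [Matrix.trace_add, Matrix.trace_smul, h.trace_T, h.trace_K, smul_eq_mul]
        ring
      · have h2 : q + 1 ≠ 0 := by intro h; linarith
        have h3 : 1 - q * n ≠ 0 := by intro h; linarith
        positivity
      · simp only [mul_add, mul_smul_comm, h.mul_T, h.mul_K]
        module
    · exact Matrix.mem_spectrum_of_mul_eq_smul (hne 1 (by rw [h.trace_K, one_mul]) one_ne_zero)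
        h.mul_K

theorem cospectral {G : SimpleGraph V} {H : SimpleGraph W} [DecidableRel G.Adj] [DecidableRel H.Adj]
    (h : CliqueAlgebra (G.adjMatrix ℝ + 1) T K a q n N)
    (h' : CliqueAlgebra (H.adjMatrix ℝ + 1) T' K' a q n N)
    (hcard : Fintype.card V = Fintype.card W) : Cospectral G H := by
  have key : (G.adjMatrix ℝ).charpoly.roots = (H.adjMatrix ℝ).charpoly.roots := by
    apply Matrix.IsHermitian.roots_charpoly_eq_of_trace_aeval_eq
    · exact Matrix.isHermitian_iff_isSymm.2 G.isSymm_adjMatrix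
    · exact Matrix.isHermitian_iff_isSymm.2 H.isSymm_adjMatrix
    · intro p
      -- Composing with X - 1 turns polynomials in A + I into polynomials in A.
      have := h.trace_aeval_eq h' hcard (p.comp (Polynomial.X - 1))
      simpa [aeval_comp] using this
  unfold Cospectral graphSpectrum
  convert key

theorem numDistinctEigenvalues_eq {G : SimpleGraph V} [DecidableRel G.Adj]
    (h : CliqueAlgebra (G.adjMatrix ℝ + 1) T K a q n N) (hq : 2 ≤ q) (hn : 2 ≤ n) (ha : q < a)
    (hN : 0 < N) (hcard : Fintype.card V = N) : numDistinctEigenvalues G = 4 := by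
  have hκ : 4 ≤ q * n := by nlinarith
  have ha0 : 0 < a := by linarith
  have key : (G.adjMatrix ℝ).charpoly.roots.toFinset =
      {-1, -a - 1, a * (n - 1) - 1, a * (q * n + n - 1) - 1} := by
    ext θ
    rw [Multiset.mem_toFinset, Polynomial.mem_roots (Matrix.charpoly_monic _).ne_zero,
      ← Matrix.mem_spectrum_iff_isRoot_charpoly]
    have hs : θ ∈ spectrum ℝ (G.adjMatrix ℝ) ↔ θ + 1 ∈ spectrum ℝ (G.adjMatrix ℝ + 1) := by
      rw [spectrum.mem_iff, spectrum.mem_iff, map_add, map_one, add_sub_add_right_eq_sub]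
    rw [hs, h.spectrum_eq hq hn ha hN hcard]
    simp only [Set.mem_insert_iff, Set.mem_singleton_iff, Finset.mem_insert, Finset.mem_singleton,
      eq_sub_iff_add_eq, eq_neg_iff_add_eq_zero]
  have hfour : ({-1, -a - 1, a * (n - 1) - 1, a * (q * n + n - 1) - 1} : Finset ℝ).card = 4 := by
    have h1 : 0 < a * (n - 1) := mul_pos ha0 (by linarith)
    have h2 : a * (n - 1) < a * (q * n + n - 1) := by nlinarith
    rw [Finset.card_insert_of_notMem, Finset.card_insert_of_notMem, Finset.card_pair]
    · intro h; linarith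
    · simp only [Finset.mem_insert, Finset.mem_singleton, not_or]
      constructor <;> intro h <;> linarith
    · simp only [Finset.mem_insert, Finset.mem_singleton, not_or]
      refine ⟨?_, ?_, ?_⟩ <;> intro h <;> linarith
  unfold numDistinctEigenvalues graphSpectrum
  rw [← hfour, ← key]
  congr!

end CliqueAlgebra

/-! ### Clique extensions as blown-up matrices -/

section CliqueExtension

variable {V : Type*}

theorem cliqueExtension_adj {m : ℕ} {G : SimpleGraph V} {u v : V × Fin m} :
    (cliqueExtension m G).Adj u v ↔ u ≠ v ∧ (u.1 = v.1 ∨ G.Adj u.1 v.1) :=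
  Iff.rfl

theorem cliqueExtension_adjMatrix_add_one [DecidableEq V] (m : ℕ) (G : SimpleGraph V) [DecidableRel G.Adj]
    [DecidableRel (cliqueExtension m G).Adj] :
    (cliqueExtension m G).adjMatrix ℝ + 1 = (G.adjMatrix ℝ + 1).submatrix Prod.fst Prod.fst := by
  ext ⟨x, a⟩ ⟨y, b⟩
  simp only [Matrix.add_apply, SimpleGraph.adjMatrix_apply, Matrix.one_apply, Matrix.submatrix_apply,
    cliqueExtension_adj, Prod.mk.injEq, ne_eq]
  by_cases hxy : x = y
  · subst hxy
    by_cases hab : a = b <;> simp [hab]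
  · simp [hxy]

theorem submatrix_fst_mul_submatrix_fst [Fintype V] (m : ℕ) (A B : Matrix V V ℝ) :
    A.submatrix (Prod.fst : V × Fin m → V) (Prod.fst : V × Fin m → V) *
      B.submatrix (Prod.fst : V × Fin m → V) (Prod.fst : V × Fin m → V) =
    (m : ℝ) • (A * B).submatrix Prod.fst Prod.fst := by
  ext u v
  simp [Matrix.mul_apply, Fintype.sum_prod_type, Finset.mul_sum]

theorem trace_submatrix_fst [Fintype V] (m : ℕ) (A : Matrix V V ℝ) :
    (A.submatrix (Prod.fst : V × Fin m → V) (Prod.fst : V × Fin m → V)).trace = m * A.trace := by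
  simp [Matrix.trace, Fintype.sum_prod_type, Finset.mul_sum]

/-- A + I of the extension is A + I of the graph with every entry blown up to a constant m × m
block, so each product gains a factor m, absorbed by a, and so does each trace. -/
theorem CliqueAlgebra.cliqueExtension [Fintype V] [DecidableEq V] {G : SimpleGraph V} [DecidableRel G.Adj]
    {T K : Matrix V V ℝ} {a q n N : ℝ} (h : CliqueAlgebra (G.adjMatrix ℝ + 1) T K a q n N) (m : ℕ)
    [DecidableRel (cliqueExtension m G).Adj] :
    CliqueAlgebra ((cliqueExtension m G).adjMatrix ℝ + 1) (T.submatrix Prod.fst Prod.fst)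
      (K.submatrix Prod.fst Prod.fst) (m * a) q n (m * N) := by
  rw [cliqueExtension_adjMatrix_add_one]
  constructor
  · rw [submatrix_fst_mul_submatrix_fst, h.mul_self]
    ext u v
    simp only [Matrix.smul_apply, Matrix.submatrix_apply, Matrix.add_apply, smul_eq_mul]
    ring
  · rw [submatrix_fst_mul_submatrix_fst, h.mul_T]
    ext u v
    simp only [Matrix.smul_apply, Matrix.submatrix_apply, Matrix.add_apply, smul_eq_mul]
    ring
  · rw [submatrix_fst_mul_submatrix_fst, h.mul_K]
    ext u v
    simp only [Matrix.smul_apply, Matrix.submatrix_apply, smul_eq_mul]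
    ring
  · rw [trace_submatrix_fst, h.trace_X]
  · rw [trace_submatrix_fst, h.trace_T]; ring
  · rw [trace_submatrix_fst, h.trace_K]

end CliqueExtension

/-! ### Agreement matrices of orthogonal families -/

/-- The matrix all of whose entries are one. -/
def onesMatrix (V : Type*) : Matrix V V ℝ := Matrix.of fun _ _ => 1

/-- The entry at `u, v` is the number of members of the family `f` that agree on `u` and `v`. -/
def agreementMatrix {ι V κ : Type*} [Fintype ι] [DecidableEq κ] (f : ι → V → κ) : Matrix V V ℝ :=
  Matrix.of fun u v => ∑ p, if f p u = f p v then 1 else 0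

/-- A family of functions all of whose fibres have `c` elements, and such that fibres of two
different members of the family meet in `d` elements. -/
structure IsOrthogonalFamily {ι V κ : Type*} [Fintype V] [DecidableEq κ] (f : ι → V → κ)
    (c d : ℕ) : Prop where
  card_fibre : ∀ p a, (Finset.univ.filter fun w => f p w = a).card = c
  card_inter : ∀ p p', p ≠ p' → ∀ a b,
    (Finset.univ.filter fun w => f p w = a ∧ f p' w = b).card = d

namespace IsOrthogonalFamily

variable {ι V κ : Type*} [Fintype V] [DecidableEq κ] {f : ι → V → κ} {c d : ℕ}

theorem sum_indicator (h : IsOrthogonalFamily f c d) (p : ι) (a : κ) :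
    ∑ w, (if f p w = a then (1 : ℝ) else 0) = c := by
  rw [Finset.sum_boole, h.card_fibre]

/-- The sum of the agreement numbers of `x` with the points of a fibre. -/
theorem sum_agreement [Fintype ι] (h : IsOrthogonalFamily f c d) (x : V) (p : ι) (a : κ) :
    ∑ w, agreementMatrix f x w * (if f p w = a then 1 else 0) =
      ((Fintype.card ι - 1 : ℝ) * d) + (c : ℝ) * (if f p x = a then 1 else 0) := by
  classical
  -- A member p' ≠ p contributes d, the size of the intersection of two fibres; p itself contributes
  -- c or 0. Writing this as d plus a correction at p makes the sum over p' immediate.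
  have key : ∀ p', ∑ w, (if f p' x = f p' w then (1 : ℝ) else 0) * (if f p w = a then 1 else 0) =
      d + (if p' = p then (c : ℝ) * (if f p x = a then 1 else 0) - d else 0) := by
    intro p'
    by_cases hp : p' = p
    · subst hp
      have : ∀ w, (if f p' x = f p' w then (1 : ℝ) else 0) * (if f p' w = a then 1 else 0) =
          (if f p' w = a then 1 else 0) * (if f p' x = a then 1 else 0) := by
        intro w
        by_cases hw : f p' w = a
        · simp [hw]
        · simp [hw]
      rw [Finset.sum_congr rfl fun w _ => this w, ← Finset.sum_mul, h.sum_indicator]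
      simp
    · simp only [hp, if_false, add_zero]
      rw [← h.card_inter p' p hp (f p' x) a, ← Finset.sum_boole]
      refine Finset.sum_congr rfl fun w _ => ?_
      simp only [eq_comm (a := f p' x)]
      by_cases h1 : f p' w = f p' x <;> by_cases h2 : f p w = a <;> simp [h1, h2]
  simp only [agreementMatrix, Matrix.of_apply, Finset.sum_mul]
  rw [Finset.sum_comm, Finset.sum_congr rfl fun p' _ => key p', Finset.sum_add_distrib]
  simp only [Finset.sum_const, Finset.card_univ, nsmul_eq_mul, Finset.sum_ite_eq', Finset.mem_univ,
    if_true]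
  ring

theorem agreementMatrix_mul_self [Fintype ι] (h : IsOrthogonalFamily f c d) :
    agreementMatrix f * agreementMatrix f =
      (c : ℝ) • agreementMatrix f +
        ((Fintype.card ι : ℝ) * (Fintype.card ι - 1) * d) • onesMatrix V := by
  ext u v
  have : ∀ w, agreementMatrix f u w * agreementMatrix f w v =
      ∑ p, agreementMatrix f u w * (if f p w = f p v then 1 else 0) := by
    intro w
    rw [← Finset.mul_sum]
    rfl
  rw [Matrix.mul_apply, Finset.sum_congr rfl fun w _ => this w, Finset.sum_comm,
    Finset.sum_congr rfl fun p _ => h.sum_agreement u p (f p v), Finset.sum_add_distrib]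
  simp only [← Finset.mul_sum, Finset.sum_const, Finset.card_univ, nsmul_eq_mul, Matrix.add_apply, Matrix.smul_apply,
    smul_eq_mul, onesMatrix, agreementMatrix, Matrix.of_apply]
  ring

theorem agreementMatrix_mul_ones [Fintype ι] (h : IsOrthogonalFamily f c d) :
    agreementMatrix f * onesMatrix V = ((Fintype.card ι : ℝ) * c) • onesMatrix V := by
  ext u v
  simp only [Matrix.mul_apply, onesMatrix, agreementMatrix, Matrix.of_apply, mul_one,
    Matrix.smul_apply, smul_eq_mul]
  rw [Finset.sum_comm]
  simp only [eq_comm (a := f _ u)]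
  simp [h.card_fibre]

end IsOrthogonalFamily

theorem agreementMatrix_diag {ι V κ : Type*} [Fintype ι] [DecidableEq κ] (f : ι → V → κ) (u : V) :
    agreementMatrix f u u = Fintype.card ι := by
  simp [agreementMatrix]

theorem trace_agreementMatrix {ι V κ : Type*} [Fintype ι] [Fintype V] [DecidableEq κ]
    (f : ι → V → κ) : (agreementMatrix f).trace = Fintype.card ι * Fintype.card V := by
  simp [Matrix.trace, agreementMatrix_diag, mul_comm]

theorem trace_onesMatrix (V : Type*) [Fintype V] : (onesMatrix V).trace = Fintype.card V := by
  simp [Matrix.trace, onesMatrix]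

theorem agreementMatrix_comm {ι V κ : Type*} [Fintype ι] [DecidableEq κ] (f : ι → V → κ)
    (u v : V) : agreementMatrix f u v = agreementMatrix f v u := by
  simp only [agreementMatrix, Matrix.of_apply, eq_comm (a := f _ u)]

/-- If no two members of the family agree on both points, then the agreement number tells whether
some member agrees on them. -/
theorem agreementMatrix_eq_ite {ι V κ : Type*} [Fintype ι] [DecidableEq κ]
    (f : ι → V → κ) (u v : V) (huniq : ∀ p p', f p u = f p v → f p' u = f p' v → p = p')
    [Decidable (∃ p, f p u = f p v)] :
    agreementMatrix f u v = if ∃ p, f p u = f p v then 1 else 0 := by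
  classical
  split_ifs with h
  · obtain ⟨p, hp⟩ := h
    rw [agreementMatrix, Matrix.of_apply, Finset.sum_eq_single p]
    · simp [hp]
    · intro p' _ hne
      rw [if_neg fun hp' => hne (huniq p' p hp' hp)]
    · simp
  · push Not at h
    simp [agreementMatrix, h]

/-- A family of functions with prescribed pairwise intersections of fibres is orthogonal. -/
theorem IsOrthogonalFamily.of_card_inter {ι V κ : Type*} [Nontrivial ι] [Fintype V] [Fintype κ]
    [DecidableEq κ] {f : ι → V → κ} {d : ℕ}
    (h : ∀ p p', p ≠ p' → ∀ a b, (Finset.univ.filter fun w => f p w = a ∧ f p' w = b).card = d) :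
    IsOrthogonalFamily f (Fintype.card κ * d) d := by
  refine ⟨fun p a => ?_, h⟩
  obtain ⟨p', hp'⟩ := exists_ne p
  -- The fibres of any second member cut the given fibre into pieces of size d.
  rw [Finset.card_eq_sum_card_fiberwise (f := f p') (t := Finset.univ) (by simp)]
  simp only [Finset.filter_filter, h p p' hp'.symm]
  simp

theorem card_filter_eq_one_of_card_image {n : ℕ} {f g : Fin (n ^ 2) → Fin n}
    (h : (Finset.univ.image fun l => (f l, g l)).card = n ^ 2) (a b : Fin n) :
    (Finset.univ.filter fun l => f l = a ∧ g l = b).card = 1 := by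
  have hinj : Function.Injective fun l => (f l, g l) := by
    rw [← Set.injOn_univ, ← Finset.coe_univ, ← Finset.card_image_iff, h, Finset.card_fin]
  have hbij : Function.Bijective fun l => (f l, g l) := by
    rw [Fintype.bijective_iff_injective_and_card]
    exact ⟨hinj, by simp [sq]⟩
  rw [Finset.card_eq_one]
  obtain ⟨w, hw, huniq⟩ := hbij.existsUnique (a, b)
  refine ⟨w, ?_⟩
  ext x
  simp only [Finset.mem_filter, Finset.mem_univ, true_and, Finset.mem_singleton]
  constructor
  · rintro ⟨rfl, rfl⟩
    exact huniq x rfl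
  · rintro rfl
    exact Prod.mk.inj hw

/-! ### Latin Square graphs -/

theorem OrthogonalArray.cliqueAlgebra {q n : ℕ} (hq : q ≠ 0)
    (O : OrthogonalArray (q * n) (q + 1)) [DecidableRel O.latinSquareGraph.Adj] :
    CliqueAlgebra (O.latinSquareGraph.adjMatrix ℝ + 1) (agreementMatrix O.row)
      (onesMatrix (Fin ((q * n) ^ 2))) q q n ((q * n) ^ 2) := by
  have : Nontrivial (Fin (q + 1)) := Fin.nontrivial_iff_two_le.2 (by omega)
  have horth : ∀ p p', p ≠ p' → ∀ a b,
      (Finset.univ.filter fun w => O.row p w = a ∧ O.row p' w = b).card = 1 :=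
    fun p p' hp a b => card_filter_eq_one_of_card_image (O.orthogonal p p' hp) a b
  have hfam : IsOrthogonalFamily O.row (q * n) 1 := by
    simpa using IsOrthogonalFamily.of_card_inter horth
  -- Distinct columns agree in at most one row, so the agreement matrix is already 0/1 off the
  -- diagonal; on the diagonal it is q + 1 instead of 1.
  have hX : O.latinSquareGraph.adjMatrix ℝ + 1 =
      agreementMatrix O.row - (q : ℝ) • (1 : Matrix (Fin ((q * n) ^ 2)) (Fin ((q * n) ^ 2)) ℝ) := by
    ext u v
    by_cases huv : u = v
    · subst huv
      simp [agreementMatrix_diag]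
    · have huniq : ∀ p p', O.row p u = O.row p v → O.row p' u = O.row p' v → p = p' := by
        intro p p' h1 h2
        by_contra hp
        obtain ⟨w, hw⟩ := Finset.card_eq_one.1 (horth p p' hp (O.row p v) (O.row p' v))
        have hu : u ∈ ({w} : Finset _) := hw ▸ by simp [h1, h2]
        have hv : v ∈ ({w} : Finset _) := hw ▸ by simp
        rw [Finset.mem_singleton] at hu hv
        exact huv (hu.trans hv.symm)
      classical
      rw [Matrix.sub_apply, agreementMatrix_eq_ite _ _ _ huniq]
      have hadj : O.latinSquareGraph.Adj u v ↔ u ≠ v ∧ ∃ p, O.row p u = O.row p v := Iff.rfl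
      simp [hadj, huv]
  have hS2 := hfam.agreementMatrix_mul_self
  have hSK := hfam.agreementMatrix_mul_ones
  rw [Fintype.card_fin] at hS2 hSK
  push_cast at hS2 hSK
  rw [hX]
  constructor
  · simp only [sub_mul, mul_sub, hS2, mul_smul_comm, mul_one, smul_mul_assoc, one_mul]
    module
  · rw [sub_mul, hS2, smul_mul_assoc, one_mul]
    module
  · rw [sub_mul, hSK, smul_mul_assoc, one_mul]
    module
  · rw [Matrix.trace_sub, Matrix.trace_smul, trace_agreementMatrix, Matrix.trace_one]
    simp
    ring
  · rw [trace_agreementMatrix]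
    simp
  · rw [trace_onesMatrix]
    simp

/-! ### The twisted family and its same-column correction -/

section Twisted

variable {ι P C α β : Type*} [DecidableEq α] [DecidableEq β]

/-- The functions whose fibres are the classes of the parallelism relations of a twisted Latin Square
graph: `l p x` is the member of the `p`-th parallel class containing `x`. -/
def twistedFamily (l : ι → P → α) (r : ι → α → C → β) (p : ι) (u : P × C) : α × β :=
  (l p u.1, r p (l p u.1) u.2)

theorem agreementMatrix_twistedFamily_same_column [Fintype ι] (l : ι → P → α)
    (r : ι → α → C → β) (x y : P) (i : C) :
    agreementMatrix (twistedFamily l r) (x, i) (y, i) = agreementMatrix l x y := by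
  simp only [agreementMatrix, Matrix.of_apply]
  refine Finset.sum_congr rfl fun p _ => ?_
  simp only [twistedFamily, Prod.mk.injEq]
  by_cases h : l p x = l p y <;> simp [h]

variable {l : ι → P → α} {r : ι → α → C → β} {c d : ℕ}

/-- The intersection of two fibres is a product: d points common to two planes, times the single
column with prescribed entries in two rows of different groups. -/
theorem isOrthogonalFamily_twistedFamily [Fintype P] [Fintype C] [Nontrivial ι] [Fintype α] [Fintype β]
    (hl : IsOrthogonalFamily l c d)
    (hr : ∀ p p', p ≠ p' → ∀ a a' b b',
      (Finset.univ.filter fun k => r p a k = b ∧ r p' a' k = b').card = 1) :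
    IsOrthogonalFamily (twistedFamily l r) (Fintype.card (α × β) * d) d := by
  refine IsOrthogonalFamily.of_card_inter ?_
  rintro p p' hp ⟨a, b⟩ ⟨a', b'⟩
  have : (Finset.univ.filter fun w => twistedFamily l r p w = (a, b) ∧
      twistedFamily l r p' w = (a', b')) =
      (Finset.univ.filter fun z => l p z = a ∧ l p' z = a') ×ˢ
        (Finset.univ.filter fun k => r p a k = b ∧ r p' a' k = b') := by
    ext ⟨z, k⟩
    simp only [twistedFamily, Prod.mk.injEq, Finset.mem_filter, Finset.mem_univ, true_and,
      Finset.mem_product]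
    constructor
    · rintro ⟨⟨rfl, rfl⟩, rfl, rfl⟩
      simp
    · rintro ⟨⟨rfl, rfl⟩, rfl, rfl⟩
      simp
  rw [this, Finset.card_product, hl.card_inter p p' hp, hr p p' hp, mul_one]

/-- The matrix supported on pairs of vertices in the same column, where it makes up for the agreement
numbers different from one. -/
def twistedCorrection [Fintype ι] [DecidableEq C] (l : ι → P → α) :
    Matrix (P × C) (P × C) ℝ :=
  Matrix.of fun u v => if u.2 = v.2 then 1 - agreementMatrix l u.1 v.1 else 0

variable [Fintype ι] [DecidableEq C]

theorem twistedCorrection_apply (u v : P × C) : twistedCorrection l u v =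
    if u.2 = v.2 then 1 - agreementMatrix l u.1 v.1 else 0 := rfl

theorem twistedCorrection_comm (u v : P × C) :
    twistedCorrection l u v = twistedCorrection l v u := by
  simp only [twistedCorrection, Matrix.of_apply, eq_comm (a := u.2), agreementMatrix_comm l u.1]

variable [Fintype P] [Fintype C]

theorem sum_twistedCorrection_mul (u : P × C) (g : P × C → ℝ) :
    ∑ w, twistedCorrection l u w * g w =
      ∑ z, (1 - agreementMatrix l u.1 z) * g (z, u.2) := by
  simp only [twistedCorrection, Matrix.of_apply, Fintype.sum_prod_type, ite_mul, zero_mul,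
    Finset.sum_ite_eq, Finset.mem_univ, if_true]

/-- Within a column, summing 1 minus the agreement with x over a fibre of `l` gives c - (t-1)d -
c·[x in the fibre], where t is the number of classes. The assumption c = (t-1)d leaves only -c times
the indicator of the fibre. -/
theorem twistedCorrection_mul_agreementMatrix (hl : IsOrthogonalFamily l c d)
    (hc : (c : ℝ) = (Fintype.card ι - 1) * d) :
    twistedCorrection l * agreementMatrix (twistedFamily l r) =
      (-(c : ℝ)) • agreementMatrix (twistedFamily l r) := by
  ext u v
  rw [Matrix.mul_apply, sum_twistedCorrection_mul]
  have hsplit : ∀ z p, (if twistedFamily l r p (z, u.2) = twistedFamily l r p v then (1 : ℝ) else 0)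
      = (if l p z = l p v.1 then 1 else 0) *
        (if r p (l p v.1) u.2 = r p (l p v.1) v.2 then 1 else 0) := by
    intro z p
    simp only [twistedFamily, Prod.mk.injEq]
    by_cases h : l p z = l p v.1 <;> simp [h]
  have hsum : ∀ p, ∑ z, (1 - agreementMatrix l u.1 z) * (if l p z = l p v.1 then (1 : ℝ) else 0) =
      (-(c : ℝ)) * (if l p u.1 = l p v.1 then 1 else 0) := by
    intro p
    simp only [sub_mul, one_mul, Finset.sum_sub_distrib]
    rw [hl.sum_agreement, hl.sum_indicator, ← hc]
    ring
  simp only [agreementMatrix, Matrix.of_apply, Matrix.smul_apply, smul_eq_mul, Finset.mul_sum]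
  rw [Finset.sum_comm]
  refine Finset.sum_congr rfl fun p _ => ?_
  simp only [hsplit u.1 p, hsplit _ p, ← mul_assoc, ← Finset.sum_mul]
  rw [← hsum p]
  rfl

theorem twistedCorrection_mul_ones (hl : IsOrthogonalFamily l c d)
    (hP : (Fintype.card P : ℝ) = (Fintype.card ι - 1) * c) :
    twistedCorrection l * onesMatrix (P × C) = (-(c : ℝ)) • onesMatrix (P × C) := by
  ext u v
  have h := congrFun₂ hl.agreementMatrix_mul_ones u.1 u.1
  simp only [Matrix.mul_apply, onesMatrix, Matrix.of_apply, mul_one, Matrix.smul_apply,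
    smul_eq_mul] at h
  rw [Matrix.mul_apply, sum_twistedCorrection_mul]
  simp only [onesMatrix, Matrix.of_apply, mul_one, Matrix.smul_apply, smul_eq_mul,
    Finset.sum_sub_distrib, h]
  simp only [Finset.sum_const, Finset.card_univ, nsmul_eq_mul, hP]
  ring

/-- Each column block is J - M, with J all ones and M the agreement matrix of `l`. Expanding with M²
= cM + t(t-1)dJ, MJ = JM = tcJ and J² = |P|J, the two numerical assumptions collapse the square to
-c(J - M). -/
theorem twistedCorrection_mul_self (hl : IsOrthogonalFamily l c d)
    (hc : (c : ℝ) = (Fintype.card ι - 1) * d)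
    (hP : (Fintype.card P : ℝ) = (Fintype.card ι - 1) * c) :
    twistedCorrection l * twistedCorrection l =
      (-(c : ℝ)) • (twistedCorrection l : Matrix (P × C) (P × C) ℝ) := by
  ext u v
  have h1 := congrFun₂ hl.agreementMatrix_mul_ones u.1 v.1
  have h2 := congrFun₂ hl.agreementMatrix_mul_self u.1 v.1
  simp only [Matrix.mul_apply, onesMatrix, Matrix.of_apply, mul_one, Matrix.smul_apply,
    Matrix.add_apply, smul_eq_mul] at h1 h2
  rw [Matrix.mul_apply, sum_twistedCorrection_mul]
  simp only [twistedCorrection_apply, Matrix.smul_apply, smul_eq_mul]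
  by_cases huv : u.2 = v.2
  · simp only [huv, if_true, mul_sub, sub_mul, mul_one, one_mul, Finset.sum_sub_distrib, h1, h2]
    have h3 : ∑ z, agreementMatrix l z v.1 = (Fintype.card ι : ℝ) * c := by
      have h3 := congrFun₂ hl.agreementMatrix_mul_ones v.1 v.1
      simp only [Matrix.mul_apply, onesMatrix, Matrix.of_apply, mul_one, Matrix.smul_apply,
        smul_eq_mul] at h3
      rw [← h3]
      exact Finset.sum_congr rfl fun z _ => agreementMatrix_comm l z v.1
    rw [h3]
    simp only [Finset.sum_const, Finset.card_univ, nsmul_eq_mul, hP]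
    linear_combination (-(Fintype.card ι : ℝ)) * hc
  · simp [huv]

/-- With q + 1 classes, q³ points, c = q² and d = q, both numerical assumptions on the correction
hold. For S the agreement matrix and C the correction, X = S + C gives X² = XS + (S + C)C = XS -
q²X. -/
theorem twisted_cliqueAlgebra [DecidableEq P] [Fintype α] [Fintype β] [Nontrivial ι] {q : ℕ}
    (hι : Fintype.card ι = q + 1) (hα : Fintype.card α = q) (hP : Fintype.card P = q ^ 3)
    (hl : IsOrthogonalFamily l (q * q) q)
    (hr : ∀ p p', p ≠ p' → ∀ a a' b b',
      (Finset.univ.filter fun k => r p a k = b ∧ r p' a' k = b').card = 1) :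
    CliqueAlgebra (agreementMatrix (twistedFamily l r) + twistedCorrection l)
      (agreementMatrix (twistedFamily l r)) (onesMatrix (P × C)) ((q : ℝ) ^ 2) q (Fintype.card β)
      (Fintype.card (P × C)) := by
  have hf := isOrthogonalFamily_twistedFamily hl hr
  have hc : ((q * q : ℕ) : ℝ) = (Fintype.card ι - 1) * q := by rw [hι]; push_cast; ring
  have hP' : (Fintype.card P : ℝ) = (Fintype.card ι - 1) * (q * q : ℕ) := by
    rw [hι, hP]; push_cast; ring
  have hS2 := hf.agreementMatrix_mul_self
  have hSK := hf.agreementMatrix_mul_ones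
  have hCS := twistedCorrection_mul_agreementMatrix (r := r) hl hc
  have hCK := twistedCorrection_mul_ones (C := C) hl hP'
  have hC2 := twistedCorrection_mul_self (C := C) hl hc hP'
  -- Transpose of `hCS`, as both matrices are symmetric.
  have hSC : agreementMatrix (twistedFamily l r) * twistedCorrection l =
      (-((q * q : ℕ) : ℝ)) • agreementMatrix (twistedFamily l r) := by
    rw [← hCS]
    ext u v
    have h := congrFun₂ hCS u v
    have h' := congrFun₂ hCS v u
    rw [Matrix.smul_apply] at h h'
    rw [h, agreementMatrix_comm, ← h', Matrix.mul_apply, Matrix.mul_apply]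
    refine Finset.sum_congr rfl fun w _ => ?_
    rw [mul_comm, twistedCorrection_comm, agreementMatrix_comm]
  rw [Fintype.card_prod, hα, hι] at hS2 hSK
  push_cast at hS2 hSK hCS hCK hC2 hSC
  constructor
  · rw [add_mul, mul_add, mul_add, hS2, hCS, hSC, hC2]
    module
  · rw [add_mul, hS2, hCS]
    module
  · rw [add_mul, hSK, hCK]
    module
  · rw [Matrix.trace]
    simp [twistedCorrection_apply, agreementMatrix_diag]
  · rw [trace_agreementMatrix, hι]
    simp
  · rw [trace_onesMatrix]

end Twisted

/-! ### Agreement numbers of points under parallel classes -/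

/-- The family of functions obtained from parallel classes of planes in a `3`-space. -/
structure IsParallelFamily {P : Type*} [Fintype P] {q : ℕ} (l : Fin (q + 1) → P → Fin q) :
    Prop where
  orthogonal : IsOrthogonalFamily l (q * q) q
  card_inter_inter : ∀ h i k, h < i → i < k → ∀ a b c,
    (Finset.univ.filter fun w => l h w = a ∧ l i w = b ∧ l k w = c).card = 1

namespace IsParallelFamily

variable {P : Type*} [Fintype P] {q : ℕ} {l : Fin (q + 1) → P → Fin q}

theorem eq_of_three (hl : IsParallelFamily l) {x y : P} {h i k : Fin (q + 1)} (hhi : h < i)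
    (hik : i < k) (hh : l h x = l h y) (hi : l i x = l i y) (hk : l k x = l k y) : x = y := by
  obtain ⟨w, hw⟩ := Finset.card_eq_one.1 (hl.card_inter_inter h i k hhi hik (l h y) (l i y) (l k y))
  have hx : x ∈ ({w} : Finset P) := hw ▸ by simp [hh, hi, hk]
  have hy : y ∈ ({w} : Finset P) := hw ▸ by simp
  rw [Finset.mem_singleton] at hx hy
  exact hx.trans hy.symm

/-- Two distinct points lie in at most two common planes. -/
theorem card_agree_le_two (hl : IsParallelFamily l) {x y : P} (hxy : x ≠ y) :
    (Finset.univ.filter fun p => l p x = l p y).card ≤ 2 := by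
  by_contra hcard
  rw [not_le, Finset.two_lt_card] at hcard
  obtain ⟨a, ha, b, hb, c, hc, hab, hac, hbc⟩ := hcard
  simp only [Finset.mem_filter, Finset.mem_univ, true_and] at ha hb hc
  apply hxy
  rcases lt_or_gt_of_ne hab with h1 | h1 <;> rcases lt_or_gt_of_ne hac with h2 | h2 <;>
    rcases lt_or_gt_of_ne hbc with h3 | h3
  · exact hl.eq_of_three h1 h3 ha hb hc
  · exact hl.eq_of_three h2 h3 ha hc hb
  · exact absurd (h1.trans h3) h2.asymm
  · exact hl.eq_of_three h2 h1 hc ha hb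
  · exact hl.eq_of_three h1 h2 hb ha hc
  · exact absurd (h1.trans h2) h3.asymm
  · exact hl.eq_of_three h3 h2 hb hc ha
  · exact hl.eq_of_three h3 h1 hc hb ha

/-- Two planes of different classes share q ≥ 2 points, and no pair of distinct points lies in a
third common plane. -/
theorem exists_agree_two (hl : IsParallelFamily l) (hq : 2 ≤ q) :
    ∃ x y, x ≠ y ∧ (Finset.univ.filter fun p => l p x = l p y).card = 2 := by
  have h01 : (⟨0, by omega⟩ : Fin (q + 1)) ≠ ⟨1, by omega⟩ := by simp
  have hcard := hl.orthogonal.card_inter _ _ h01 ⟨0, by omega⟩ ⟨0, by omega⟩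
  obtain ⟨x, hx, y, hy, hxy⟩ := Finset.one_lt_card.1 (hcard ▸ hq)
  simp only [Finset.mem_filter, Finset.mem_univ, true_and] at hx hy
  refine ⟨x, y, hxy, le_antisymm (hl.card_agree_le_two hxy) ?_⟩
  rw [← Finset.card_pair h01]
  refine Finset.card_le_card ?_
  intro p hp
  simp only [Finset.mem_insert, Finset.mem_singleton] at hp
  rcases hp with rfl | rfl
  · exact Finset.mem_filter.2 ⟨Finset.mem_univ _, hx.1.trans hy.1.symm⟩
  · exact Finset.mem_filter.2 ⟨Finset.mem_univ _, hx.2.trans hy.2.symm⟩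

/-- The planes through a point do not cover a plane that misses the point. -/
theorem exists_agree_zero (hl : IsParallelFamily l) (hq : 2 ≤ q) :
    ∃ x y, x ≠ y ∧ (Finset.univ.filter fun p => l p x = l p y).card = 0 := by
  classical
  let p₀ : Fin (q + 1) := ⟨0, by omega⟩
  let p₁ : Fin (q + 1) := ⟨1, by omega⟩
  let p₂ : Fin (q + 1) := ⟨2, by omega⟩
  have h01 : p₀ ≠ p₁ := by simp [p₀, p₁]
  have h02 : p₀ ≠ p₂ := by simp [p₀, p₂]
  have h12 : p₁ ≠ p₂ := by simp [p₁, p₂]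
  obtain ⟨x, hx⟩ : (Finset.univ.filter fun w => l p₀ w = ⟨0, by omega⟩).Nonempty := by
    rw [← Finset.card_pos, hl.orthogonal.card_fibre]
    positivity
  simp only [Finset.mem_filter, Finset.mem_univ, true_and] at hx
  let S := Finset.univ.filter fun w => l p₀ w = ⟨1, by omega⟩
  let B : Fin (q + 1) → Finset P := fun p =>
    Finset.univ.filter fun w => l p w = l p x ∧ l p₀ w = ⟨1, by omega⟩
  have hS : S.card = q * q := hl.orthogonal.card_fibre _ _
  have hB : ∀ p, p ≠ p₀ → (B p).card = q := fun p hp => hl.orthogonal.card_inter p p₀ hp _ _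
  have hB12 : (B p₁ ∩ B p₂).card = 1 := by
    rw [← hl.card_inter_inter p₀ p₁ p₂ Nat.zero_lt_one Nat.one_lt_two ⟨1, by omega⟩
      (l p₁ x) (l p₂ x)]
    congr 1
    ext w
    simp only [B, Finset.mem_inter, Finset.mem_filter, Finset.mem_univ, true_and]
    tauto
  -- The plane S misses x and has q² points; each of the q other planes through x meets it in q
  -- points. Two of these traces share a point, so removing `B p₂` from `B p₁` bounds the union by
  -- (q-1)q + (q-1) = q² - 1.
  let U := ((Finset.univ.erase p₀).erase p₁).biUnion B ∪ (B p₁ \ B p₂)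
  have hU : U.card < S.card := by
    have h1 : (((Finset.univ.erase p₀).erase p₁).biUnion B).card ≤ (q - 1) * q := by
      have := Finset.card_biUnion_le_card_mul ((Finset.univ.erase p₀).erase p₁) B q
        (fun p hp => (hB p (by simp at hp; exact hp.2)).le)
      rwa [Finset.card_erase_of_mem (by simp [h01.symm]), Finset.card_erase_of_mem (by simp),
        Finset.card_univ, Fintype.card_fin, Nat.add_sub_cancel] at this
    have h2 : (B p₁ \ B p₂).card = q - 1 := by
      rw [Finset.card_sdiff, Finset.inter_comm, hB12, hB p₁ h01.symm]
    calc U.card ≤ (q - 1) * q + (q - 1) := (Finset.card_union_le _ _).trans (by omega)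
      _ < q * q := by
        obtain ⟨r, rfl⟩ : ∃ r, q = r + 1 := ⟨q - 1, by omega⟩
        simp only [Nat.add_sub_cancel]
        nlinarith
      _ = S.card := hS.symm
  obtain ⟨y, hyS, hyU⟩ := Finset.exists_mem_notMem_of_card_lt_card hU
  have hy0 : l p₀ y = ⟨1, by omega⟩ := (Finset.mem_filter.1 hyS).2
  have hyB : ∀ p, p ≠ p₀ → y ∉ B p := by
    intro p hp hyp
    apply hyU
    by_cases hp1 : p = p₁
    · subst hp1
      by_cases hy2 : y ∈ B p₂
      · exact Finset.mem_union_left _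
          (Finset.mem_biUnion.2 ⟨p₂, by simp [h02.symm, h12.symm], hy2⟩)
      · exact Finset.mem_union_right _ (Finset.mem_sdiff.2 ⟨hyp, hy2⟩)
    · exact Finset.mem_union_left _ (Finset.mem_biUnion.2 ⟨p, by simp [hp, hp1], hyp⟩)
  have h0 : l p₀ x ≠ l p₀ y := by
    rw [hx, hy0]
    simp
  refine ⟨x, y, fun h => h0 (by rw [h]), ?_⟩
  rw [Finset.card_eq_zero, Finset.filter_eq_empty_iff]
  intro p _ hp
  by_cases hp0 : p = p₀
  · exact h0 (hp0 ▸ hp)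
  · exact hyB p hp0 (by simp [B, hp, hy0])

end IsParallelFamily

/-! ### From affine planes to class indices -/

namespace ParallelClasses

variable {q : ℕ} {F : Type} [Field F] [Fintype F]

theorem ncard_plane (Q : ParallelClasses q F) (hF : Fintype.card F = q) (i : Fin (q + 1))
    (j : Fin q) : (Q.plane i j : Set (Fin 3 → F)).ncard = q ^ 2 := by
  have hdir := Q.finrank_direction i j
  obtain ⟨x, hx⟩ : (Q.plane i j : Set (Fin 3 → F)).Nonempty := by
    rw [Set.nonempty_iff_ne_empty]
    intro h
    rw [AffineSubspace.coe_eq_bot_iff] at h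
    rw [h, AffineSubspace.direction_bot, finrank_bot] at hdir
    omega
  have himage := AffineSubspace.coe_direction_eq_vsub_set_right hx
  rw [← Set.ncard_image_of_injective _ (vsub_left_injective x), ← himage]
  have h := Module.natCard_eq_pow_finrank (K := F) (V := (Q.plane i j).direction)
  rw [hdir, Nat.card_eq_fintype_card (α := F), hF] at h
  exact h

/-- The q disjoint planes of a class, with q² points each, exhaust the q³ points. -/
theorem existsUnique_mem_plane (Q : ParallelClasses q F) (hF : Fintype.card F = q)
    (i : Fin (q + 1)) (x : Fin 3 → F) : ∃! j, x ∈ Q.plane i j := by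
  classical
  have hcover : (Finset.univ.biUnion fun j => (Q.plane i j : Set (Fin 3 → F)).toFinset) =
      Finset.univ := by
    rw [← Finset.card_eq_iff_eq_univ, Finset.card_biUnion]
    · simp only [← Set.ncard_eq_toFinset_card', Q.ncard_plane hF]
      simp [hF]
      ring
    · intro j _ j' _ hj
      exact Set.disjoint_toFinset.2 <| Q.disjoint i j j' hj
  obtain ⟨j, _, hj⟩ := Finset.mem_biUnion.1 (hcover ▸ Finset.mem_univ x)
  rw [Set.mem_toFinset] at hj
  refine ⟨j, hj, fun j' hj' => ?_⟩
  by_contra hne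
  exact Set.disjoint_left.1 (Q.disjoint i j' j hne) hj' hj

/-- The index of the plane of the `i`-th class that contains `x`. -/
noncomputable def planeIndex (Q : ParallelClasses q F) (hF : Fintype.card F = q) (i : Fin (q + 1))
    (x : Fin 3 → F) : Fin q :=
  (Q.existsUnique_mem_plane hF i x).choose

theorem planeIndex_eq_iff (Q : ParallelClasses q F) (hF : Fintype.card F = q) {i : Fin (q + 1)}
    {x : Fin 3 → F} {j : Fin q} : Q.planeIndex hF i x = j ↔ x ∈ Q.plane i j := by
  have h := (Q.existsUnique_mem_plane hF i x).choose_spec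
  exact ⟨fun e => e ▸ h.1, fun hj => (h.2 j hj).symm⟩

theorem isParallelFamily (Q : ParallelClasses q F) (hF : Fintype.card F = q)
    [Fintype (Fin 3 → F)] : IsParallelFamily (Q.planeIndex hF) := by
  have hq : 1 < q := hF ▸ Fintype.one_lt_card
  have : Nontrivial (Fin (q + 1)) := Fin.nontrivial_iff_two_le.2 (by omega)
  constructor
  · have h := IsOrthogonalFamily.of_card_inter (f := Q.planeIndex hF) (d := q) ?_
    · simpa using h
    · intro p p' hp a b
      refine Eq.trans ?_ (Q.ncard_inter p p' hp a b)
      rw [← Set.ncard_coe_finset]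
      congr 1
      ext w
      simp [planeIndex_eq_iff]
  · intro h i k hhi hik a b c
    rw [← Q.ncard_inter_inter h i k hhi hik a b c, ← Set.ncard_coe_finset]
    congr 1
    ext w
    simp [planeIndex_eq_iff, and_assoc]

end ParallelClasses

/-! ### Common neighbours, level and spectrum of the extensions -/

/-- Entries of A² = X² - 2X + I, with X² replaced by its linear expression. The case u = v is
included and gives the degree. -/
theorem CliqueAlgebra.numCommonNeighbors_eq {V : Type*} [Fintype V] [DecidableEq V]
    {G : SimpleGraph V} [DecidableRel G.Adj] {T K : Matrix V V ℝ} {a q n N : ℝ}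
    (h : CliqueAlgebra (G.adjMatrix ℝ + 1) T K a q n N) (u v : V) :
    (numCommonNeighbors G u v : ℝ) = -(a + 2) * (G.adjMatrix ℝ + 1) u v + a * (n - 1) * T u v +
      a * (q + 1) * K u v + (1 : Matrix V V ℝ) u v := by
  have hcount : (numCommonNeighbors G u v : ℝ) = (G.adjMatrix ℝ * G.adjMatrix ℝ) u v := by
    rw [numCommonNeighbors, Set.ncard_eq_toFinset_card', Matrix.mul_apply]
    have hite : ∀ w, G.adjMatrix ℝ u w * G.adjMatrix ℝ w v =
        if G.Adj u w ∧ G.Adj w v then 1 else 0 := by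
      intro w
      by_cases h1 : G.Adj u w <;> by_cases h2 : G.Adj w v <;> simp [h1, h2]
    rw [Finset.sum_congr rfl fun w _ => hite w, Finset.sum_boole]
    congr 2
    ext w
    simp [SimpleGraph.mem_commonNeighbors, SimpleGraph.adj_comm]
  have hmul : G.adjMatrix ℝ * G.adjMatrix ℝ = (G.adjMatrix ℝ + 1) * (G.adjMatrix ℝ + 1) -
      (2 : ℝ) • (G.adjMatrix ℝ + 1) + 1 := by
    rw [mul_add, add_mul, mul_one, one_mul]
    module
  rw [hcount, hmul, h.mul_self]
  simp only [Matrix.add_apply, Matrix.sub_apply, Matrix.smul_apply, smul_eq_mul]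
  ring

namespace TwistedLatinSquareDatum

theorem two_le_order {q n : ℕ} (T : TwistedLatinSquareDatum q n) : 2 ≤ q :=
  T.card_eq ▸ Fintype.one_lt_card

variable {q n : ℕ} (T : TwistedLatinSquareDatum q n)

/-- The functions whose fibres are the classes of the parallelism relations. -/
noncomputable def family : Fin (q + 1) → T.Vertex → Fin q × Fin n :=
  twistedFamily (T.classes.planeIndex T.card_eq) T.array.row

/-- The number of parallelism relations that hold between two vertices. -/
noncomputable def agreement (u v : T.Vertex) : ℕ :=
  (Finset.univ.filter fun p => T.family p u = T.family p v).card

theorem agreementMatrix_family (u v : T.Vertex) :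
    agreementMatrix T.family u v = T.agreement u v := by
  rw [agreementMatrix, Matrix.of_apply, Finset.sum_boole, agreement]

theorem card_filter_row (p p' : Fin (q + 1)) (hp : p ≠ p') (a a' : Fin q) (b b' : Fin n) :
    (Finset.univ.filter fun k => T.array.row p a k = b ∧ T.array.row p' a' k = b').card = 1 :=
  card_filter_eq_one_of_card_image (T.array.orthogonal p p' hp a a') b b'

theorem family_eq_iff {p : Fin (q + 1)} {u v : T.Vertex} : T.family p u = T.family p v ↔
    ∃ l : Fin q, u.1 ∈ T.classes.plane p l ∧ v.1 ∈ T.classes.plane p l ∧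
      T.array.row p l u.2 = T.array.row p l v.2 := by
  simp only [family, twistedFamily, Prod.mk.injEq, ← T.classes.planeIndex_eq_iff T.card_eq]
  constructor
  · rintro ⟨h1, h2⟩
    exact ⟨_, rfl, h1.symm, h2.trans (by rw [h1])⟩
  · rintro ⟨l, rfl, h2, h3⟩
    exact ⟨h2.symm, h3.trans (by rw [h2])⟩

theorem family_unique {p p' : Fin (q + 1)} {u v : T.Vertex} (huv : u.2 ≠ v.2)
    (h : T.family p u = T.family p v) (h' : T.family p' u = T.family p' v) : p = p' := by
  by_contra hp
  obtain ⟨l, _, _, hl⟩ := T.family_eq_iff.1 h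
  obtain ⟨l', _, _, hl'⟩ := T.family_eq_iff.1 h'
  obtain ⟨w, hw⟩ := Finset.card_eq_one.1
    (T.card_filter_row p p' hp l l' (T.array.row p l v.2) (T.array.row p' l' v.2))
  have hu : u.2 ∈ ({w} : Finset _) := hw ▸ by simp [hl, hl']
  have hv : v.2 ∈ ({w} : Finset _) := hw ▸ by simp
  rw [Finset.mem_singleton] at hu hv
  exact huv (hu.trans hv.symm)

theorem graph_adj {u v : T.Vertex} : T.graph.Adj u v ↔
    u ≠ v ∧ (u.2 = v.2 ∨ ∃ p, T.family p u = T.family p v) := by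
  simp only [T.family_eq_iff]
  rfl

theorem agreement_le_one {u v : T.Vertex} (huv : u.2 ≠ v.2) : T.agreement u v ≤ 1 := by
  rw [agreement, Finset.card_le_one]
  intro p hp p' hp'
  exact T.family_unique huv (Finset.mem_filter.1 hp).2 (Finset.mem_filter.1 hp').2

theorem agreement_pos_iff {u v : T.Vertex} :
    0 < T.agreement u v ↔ ∃ p, T.family p u = T.family p v := by
  rw [agreement, Finset.card_pos, Finset.filter_nonempty_iff]
  simp

theorem agreement_self (u : T.Vertex) : T.agreement u u = q + 1 := by
  simp [agreement]

theorem agreement_same_column (x y : Fin 3 → T.F) (i : Fin (n ^ 2)) :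
    T.agreement (x, i) (y, i) = (Finset.univ.filter fun p =>
      T.classes.planeIndex T.card_eq p x = T.classes.planeIndex T.card_eq p y).card := by
  rw [agreement]
  congr 1
  ext p
  simp only [Finset.mem_filter, Finset.mem_univ, true_and, family, twistedFamily, Prod.mk.injEq]
  exact ⟨fun h => h.1, fun h => ⟨h, by rw [h]⟩⟩

/-- In one column every entry of A + I is 1, which the correction enforces; across columns at most
one relation holds, so the agreement number already is the adjacency indicator. -/
theorem adjMatrix_add_one [DecidableEq T.Vertex] [DecidableRel T.graph.Adj] :
    T.graph.adjMatrix ℝ + 1 = agreementMatrix T.family +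
      twistedCorrection (T.classes.planeIndex T.card_eq) := by
  classical
  ext u v
  rw [Matrix.add_apply, Matrix.add_apply, twistedCorrection_apply]
  by_cases hcol : u.2 = v.2
  · have hS : agreementMatrix T.family u v =
        agreementMatrix (T.classes.planeIndex T.card_eq) u.1 v.1 := by
      obtain ⟨x, i⟩ := u
      obtain ⟨y, j⟩ := v
      obtain rfl : i = j := hcol
      exact agreementMatrix_twistedFamily_same_column _ _ x y i
    rw [if_pos hcol, hS, add_sub_cancel, SimpleGraph.adjMatrix_apply, Matrix.one_apply]
    by_cases huv : u = v
    · simp [huv]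
    · simp [T.graph_adj, huv, hcol]
  · have huv : u ≠ v := fun h => hcol (h ▸ rfl)
    rw [if_neg hcol, agreementMatrix_eq_ite _ _ _ fun p p' => T.family_unique hcol,
      SimpleGraph.adjMatrix_apply, Matrix.one_apply_ne huv]
    simp [T.graph_adj, huv, hcol]

theorem cliqueAlgebra [DecidableEq T.Vertex] [DecidableRel T.graph.Adj] :
    CliqueAlgebra (T.graph.adjMatrix ℝ + 1) (agreementMatrix T.family) (onesMatrix T.Vertex)
      ((q : ℝ) ^ 2) q n (q ^ 3 * n ^ 2) := by
  classical
  have hq := T.two_le_order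
  have : Nontrivial (Fin (q + 1)) := Fin.nontrivial_iff_two_le.2 (by omega)
  rw [T.adjMatrix_add_one]
  have h := twisted_cliqueAlgebra (q := q) (by simp) (by simp) (by simp [T.card_eq])
    (T.classes.isParallelFamily T.card_eq).orthogonal T.card_filter_row
  simp only [Fintype.card_fin, Fintype.card_prod, Fintype.card_pi, Finset.prod_const,
    Finset.card_univ, T.card_eq] at h
  push_cast at h
  convert h <;> rfl

/-- The numbers of parallelism relations between adjacent vertices of the clique extension. -/
def extensionAgreements (m : ℕ) : Set ℕ :=
  {t | ∃ u v, (cliqueExtension m T.graph).Adj u v ∧ T.agreement u.1 v.1 = t}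

theorem agreement_mem_of_adj {u v : T.Vertex} (h : T.graph.Adj u v) :
    T.agreement u v ∈ ({0, 1, 2} : Set ℕ) := by
  have hle : T.agreement u v ≤ 2 := by
    by_cases hcol : u.2 = v.2
    · obtain ⟨x, i⟩ := u
      obtain ⟨y, j⟩ := v
      obtain rfl : i = j := hcol
      rw [T.agreement_same_column]
      refine (T.classes.isParallelFamily T.card_eq).card_agree_le_two ?_
      rintro rfl
      exact h.ne rfl
    · exact (T.agreement_le_one hcol).trans one_le_two
  simp only [Set.mem_insert_iff, Set.mem_singleton_iff]
  omega

theorem exists_adj_agreement (hn : 2 ≤ n) {t : ℕ} (ht : t ∈ ({0, 1, 2} : Set ℕ)) :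
    ∃ u v, T.graph.Adj u v ∧ T.agreement u v = t := by
  have hq := T.two_le_order
  let i₀ : Fin (n ^ 2) := ⟨0, by positivity⟩
  have hcol : ∀ {x y : Fin 3 → T.F}, x ≠ y → T.graph.Adj (x, i₀) (y, i₀) := fun hxy =>
    T.graph_adj.2 ⟨fun h => hxy (Prod.mk.inj h).1, Or.inl rfl⟩
  simp only [Set.mem_insert_iff, Set.mem_singleton_iff] at ht
  rcases ht with rfl | rfl | rfl
  · obtain ⟨x, y, hxy, h⟩ := (T.classes.isParallelFamily T.card_eq).exists_agree_zero hq
    exact ⟨_, _, hcol hxy, (T.agreement_same_column x y i₀).trans h⟩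
  · have hlt : Fintype.card (Fin n) < Fintype.card (Fin (n ^ 2)) := by
      rw [Fintype.card_fin, Fintype.card_fin]
      nlinarith
    obtain ⟨i, j, hij, hrow⟩ := Fintype.exists_ne_map_eq_of_card_lt
      (T.array.row 0 (T.classes.planeIndex T.card_eq 0 0)) hlt
    have hfam : ∃ p, T.family p (0, i) = T.family p (0, j) :=
      ⟨0, by simp [family, twistedFamily, hrow]⟩
    refine ⟨(0, i), (0, j), T.graph_adj.2 ⟨fun h => hij (Prod.mk.inj h).2, Or.inr hfam⟩, ?_⟩
    exact le_antisymm (T.agreement_le_one hij) (T.agreement_pos_iff.2 hfam)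
  · obtain ⟨x, y, hxy, h⟩ := (T.classes.isParallelFamily T.card_eq).exists_agree_two hq
    exact ⟨_, _, hcol hxy, (T.agreement_same_column x y i₀).trans h⟩

theorem subset_extensionAgreements (hn : 2 ≤ n) {m : ℕ} (hm : 1 ≤ m) :
    {0, 1, 2} ⊆ T.extensionAgreements m := by
  intro t ht
  obtain ⟨u, v, huv, h⟩ := T.exists_adj_agreement hn ht
  exact ⟨(u, ⟨0, hm⟩), (v, ⟨0, hm⟩),
    cliqueExtension_adj.2 ⟨fun e => huv.ne (Prod.mk.inj e).1, Or.inr huv⟩, h⟩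

theorem extensionAgreements_one (hn : 2 ≤ n) : T.extensionAgreements 1 = {0, 1, 2} := by
  apply Set.Subset.antisymm ?_ (T.subset_extensionAgreements hn le_rfl)
  rintro t ⟨⟨u, a⟩, ⟨v, b⟩, huv, rfl⟩
  rcases (cliqueExtension_adj.1 huv).2 with h | h
  · exact absurd (Prod.ext h (Subsingleton.elim a b)) huv.ne
  · exact T.agreement_mem_of_adj h

/-- The extra value q + 1 comes from two copies of one vertex, which share all relations. -/
theorem extensionAgreements_of_two_le (hn : 2 ≤ n) {m : ℕ} (hm : 2 ≤ m) :
    T.extensionAgreements m = {0, 1, 2, q + 1} := by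
  have hins : ({0, 1, 2, q + 1} : Set ℕ) = insert (q + 1) {0, 1, 2} := by
    ext t
    simp only [Set.mem_insert_iff, Set.mem_singleton_iff]
    tauto
  rw [hins]
  apply Set.Subset.antisymm
  · rintro t ⟨⟨u, a⟩, ⟨v, b⟩, huv, rfl⟩
    rcases (cliqueExtension_adj.1 huv).2 with h | h
    · obtain rfl : u = v := h
      exact Or.inl (T.agreement_self u)
    · exact Or.inr (T.agreement_mem_of_adj h)
  · apply Set.insert_subset ?_ (T.subset_extensionAgreements hn (by omega))
    have hpos : 0 < n ^ 2 := by positivity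
    refine ⟨((0, ⟨0, hpos⟩), ⟨0, by omega⟩), ((0, ⟨0, hpos⟩), ⟨1, by omega⟩),
      cliqueExtension_adj.2 ⟨?_, Or.inl rfl⟩, T.agreement_self _⟩
    intro h
    simp at h

theorem cliqueExtension_cliqueAlgebra (m : ℕ) [DecidableEq T.Vertex] [DecidableRel T.graph.Adj]
    [DecidableRel (cliqueExtension m T.graph).Adj] :
    CliqueAlgebra ((cliqueExtension m T.graph).adjMatrix ℝ + 1)
      ((agreementMatrix T.family).submatrix Prod.fst Prod.fst)
      ((onesMatrix T.Vertex).submatrix Prod.fst Prod.fst) (m * (q : ℝ) ^ 2) q n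
      (m * (q ^ 3 * n ^ 2)) :=
  T.cliqueAlgebra.cliqueExtension m

theorem numCommonNeighbors_self (m : ℕ) (u : T.Vertex × Fin m) :
    (numCommonNeighbors (cliqueExtension m T.graph) u u : ℝ) =
      m * (q : ℝ) ^ 2 * (q * n + n - 1) - 1 := by
  classical
  rw [(T.cliqueExtension_cliqueAlgebra m).numCommonNeighbors_eq]
  simp only [Matrix.add_apply, SimpleGraph.adjMatrix_apply, SimpleGraph.irrefl, if_false,
    Matrix.one_apply_eq, Matrix.submatrix_apply, T.agreementMatrix_family, T.agreement_self,
    onesMatrix, Matrix.of_apply]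
  push_cast
  ring

theorem numCommonNeighbors_of_not_adj {m : ℕ} {u v : T.Vertex × Fin m} (huv : u ≠ v)
    (h : ¬ (cliqueExtension m T.graph).Adj u v) :
    numCommonNeighbors (cliqueExtension m T.graph) u v = m * q ^ 2 * (q + 1) := by
  classical
  have hagree : T.agreement u.1 v.1 = 0 := by
    by_contra hpos
    have hne : u.1 ≠ v.1 := fun e => h (cliqueExtension_adj.2 ⟨huv, Or.inl e⟩)
    exact h (cliqueExtension_adj.2 ⟨huv, Or.inr (T.graph_adj.2
      ⟨hne, Or.inr (T.agreement_pos_iff.1 (Nat.pos_of_ne_zero hpos))⟩)⟩)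
  have key := (T.cliqueExtension_cliqueAlgebra m).numCommonNeighbors_eq u v
  simp only [Matrix.add_apply, SimpleGraph.adjMatrix_apply, h, if_false,
    Matrix.one_apply_ne huv, Matrix.submatrix_apply, T.agreementMatrix_family, hagree,
    onesMatrix, Matrix.of_apply] at key
  have key' : (numCommonNeighbors (cliqueExtension m T.graph) u v : ℝ) =
      ((m * q ^ 2 * (q + 1) : ℕ) : ℝ) := by
    rw [key]
    push_cast
    ring
  exact_mod_cast key'

theorem numCommonNeighbors_of_adj {m : ℕ} {u v : T.Vertex × Fin m}
    (h : (cliqueExtension m T.graph).Adj u v) :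
    numCommonNeighbors (cliqueExtension m T.graph) u v + 2 + m * q ^ 2 * T.agreement u.1 v.1 =
      m * q ^ 3 + m * q ^ 2 * n * T.agreement u.1 v.1 := by
  classical
  have key := (T.cliqueExtension_cliqueAlgebra m).numCommonNeighbors_eq u v
  simp only [Matrix.add_apply, SimpleGraph.adjMatrix_apply, h, if_true,
    Matrix.one_apply_ne h.ne, Matrix.submatrix_apply, T.agreementMatrix_family,
    onesMatrix, Matrix.of_apply] at key
  have key' : ((numCommonNeighbors (cliqueExtension m T.graph) u v + 2 +
      m * q ^ 2 * T.agreement u.1 v.1 : ℕ) : ℝ) =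
      ((m * q ^ 3 + m * q ^ 2 * n * T.agreement u.1 v.1 : ℕ) : ℝ) := by
    push_cast
    rw [key]
    ring
  exact_mod_cast key'

theorem isCoEdgeRegular_cliqueExtension (m : ℕ) :
    IsCoEdgeRegular (cliqueExtension m T.graph) := by
  have hself : ∀ u, ((cliqueExtension m T.graph).neighborSet u).ncard =
      numCommonNeighbors (cliqueExtension m T.graph) u u := fun u => by
    rw [numCommonNeighbors, SimpleGraph.commonNeighbors, Set.inter_self]
  refine ⟨?_, m * q ^ 2 * (q + 1), fun u v => T.numCommonNeighbors_of_not_adj⟩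
  rcases isEmpty_or_nonempty (T.Vertex × Fin m) with hV | ⟨⟨u₀⟩⟩
  · exact ⟨0, fun u => hV.elim u⟩
  · refine ⟨numCommonNeighbors (cliqueExtension m T.graph) u₀ u₀, fun u => (hself u).trans ?_⟩
    exact Nat.cast_injective (R := ℝ)
      ((T.numCommonNeighbors_self m u).trans (T.numCommonNeighbors_self m u₀).symm)

theorem level_cliqueExtension (hn : 2 ≤ n) {m : ℕ} (hm : 1 ≤ m) :
    level (cliqueExtension m T.graph) = (T.extensionAgreements m).ncard := by
  have hq := T.two_le_order
  -- Here k + 1 stands for n - 1, the positive slope factor that makes `f` injective; `h8` ensures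
  -- that the truncated subtraction of 2 in `f` is genuine.
  obtain ⟨k, rfl⟩ : ∃ k, n = k + 2 := ⟨n - 2, by omega⟩
  have h8 : 8 ≤ m * q ^ 3 :=
    calc 8 = 1 * 2 ^ 3 := rfl
      _ ≤ m * q ^ 3 := by gcongr
  let f : ℕ → ℕ := fun t => m * q ^ 3 + m * q ^ 2 * (k + 1) * t - 2
  have hf : Function.Injective f := by
    intro t t' h
    have h' : m * q ^ 2 * (k + 1) * t = m * q ^ 2 * (k + 1) * t' := by
      simp only [f] at h
      omega
    exact Nat.eq_of_mul_eq_mul_left (by positivity) h'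
  have hval : ∀ {u v}, (cliqueExtension m T.graph).Adj u v →
      f (T.agreement u.1 v.1) = numCommonNeighbors (cliqueExtension m T.graph) u v := by
    intro u v h
    have key := T.numCommonNeighbors_of_adj h
    have hring : m * q ^ 2 * (k + 2) * T.agreement u.1 v.1 =
        m * q ^ 2 * (k + 1) * T.agreement u.1 v.1 + m * q ^ 2 * T.agreement u.1 v.1 := by ring
    simp only [f]
    omega
  rw [level, ← Set.ncard_image_of_injective (T.extensionAgreements m) hf]
  congr 1
  ext c
  constructor
  · rintro ⟨u, v, h, rfl⟩
    exact ⟨_, ⟨u, v, h, rfl⟩, hval h⟩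
  · rintro ⟨_, ⟨u, v, h, rfl⟩, rfl⟩
    exact ⟨u, v, h, (hval h).symm⟩

theorem level_cliqueExtension_one (hn : 2 ≤ n) : level (cliqueExtension 1 T.graph) = 3 := by
  rw [T.level_cliqueExtension hn le_rfl, T.extensionAgreements_one hn]
  have : ({0, 1, 2} : Set ℕ) = (({0, 1, 2} : Finset ℕ) : Set ℕ) := by simp
  rw [this, Set.ncard_coe_finset]
  rfl

theorem level_cliqueExtension_of_two_le (hn : 2 ≤ n) {m : ℕ} (hm : 2 ≤ m) :
    level (cliqueExtension m T.graph) = 4 := by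
  have hq := T.two_le_order
  rw [T.level_cliqueExtension hn (by omega), T.extensionAgreements_of_two_le hn hm]
  have : ({0, 1, 2, q + 1} : Set ℕ) = (({0, 1, 2, q + 1} : Finset ℕ) : Set ℕ) := by simp
  rw [this, Set.ncard_coe_finset, Finset.card_insert_of_notMem, Finset.card_insert_of_notMem,
    Finset.card_pair]
  · omega
  · simp only [Finset.mem_insert, Finset.mem_singleton]
    omega
  · simp only [Finset.mem_insert, Finset.mem_singleton]
    omega

theorem cospectral_cliqueExtension {m : ℕ} (O : OrthogonalArray (q * n) (q + 1)) :
    Cospectral (cliqueExtension m T.graph) (cliqueExtension (q * m) O.latinSquareGraph) := by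
  classical
  have hq := T.two_le_order
  have h' := (O.cliqueAlgebra (by omega)).cliqueExtension (q * m)
  have e1 : ((q * m : ℕ) : ℝ) * q = m * (q : ℝ) ^ 2 := by push_cast; ring
  have e2 : ((q * m : ℕ) : ℝ) * ((q * n) ^ 2) = m * ((q : ℝ) ^ 3 * n ^ 2) := by push_cast; ring
  rw [e1, e2] at h'
  refine CliqueAlgebra.cospectral (T.cliqueExtension_cliqueAlgebra m) h' ?_
  have hV : Fintype.card T.Vertex = q ^ 3 * n ^ 2 := by
    rw [← Nat.card_eq_fintype_card, Nat.card_prod]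
    simp [T.card_eq]
  rw [Fintype.card_prod, hV]
  simp only [Fintype.card_prod, Fintype.card_fin]
  ring

theorem numDistinctEigenvalues_cliqueExtension (hn : 2 ≤ n) {m : ℕ} (hm : 1 ≤ m) :
    numDistinctEigenvalues (cliqueExtension m T.graph) = 4 := by
  classical
  have hq := T.two_le_order
  have hV : Fintype.card T.Vertex = q ^ 3 * n ^ 2 := by
    rw [← Nat.card_eq_fintype_card, Nat.card_prod]
    simp [T.card_eq]
  refine (T.cliqueExtension_cliqueAlgebra m).numDistinctEigenvalues_eq (by exact_mod_cast hq)
    (by exact_mod_cast hn) ?_ (by positivity) ?_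
  · have : q < m * q ^ 2 := by nlinarith
    exact_mod_cast this
  · rw [Fintype.card_prod, hV, Fintype.card_fin]
    push_cast
    ring

end TwistedLatinSquareDatum

/-! ### Orthogonal arrays from lines over a finite field -/

theorem nonempty_orthogonalArray_of_field {N t : ℕ} (K : Type*) [Field K] [Fintype K]
    (hK : Fintype.card K = N) (ht : t ≤ N) : Nonempty (OrthogonalArray N t) := by
  classical
  let e : K ≃ Fin N := Fintype.equivFinOfCardEq hK
  let E : Fin (N ^ 2) ≃ K × K := (Fintype.equivFinOfCardEq (by simp [hK, sq])).symm
  let slope : Fin t → K := fun i => e.symm (Fin.castLE ht i)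
  have hslope : Function.Injective slope := e.symm.injective.comp (Fin.castLE_injective ht)
  -- Columns are points of K², and each row records the intercept of the line through a point in a
  -- fixed direction; two distinct slopes determine the point.
  refine ⟨⟨fun i c => e (slope i * (E c).1 + (E c).2), fun i j hij => ?_⟩⟩
  rw [Finset.card_image_of_injective, Finset.card_univ, Fintype.card_fin]
  intro c d hcd
  obtain ⟨h1, h2⟩ := Prod.mk.inj hcd
  replace h1 := e.injective h1
  replace h2 := e.injective h2
  have hne : slope i - slope j ≠ 0 := sub_ne_zero.2 fun h => hij (hslope h)
  have hx : (E c).1 = (E d).1 := by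
    apply mul_left_cancel₀ hne
    linear_combination h1 - h2
  apply E.injective
  refine Prod.ext hx ?_
  rw [hx] at h1
  exact add_left_cancel h1

/-! ### Parallel classes dual to a conic -/

section Conic

variable {F : Type} [Field F] {q : ℕ}

/-- The points of a normal rational curve of degree two. -/
def conicPoint (e : Fin q → F) (i : Fin (q + 1)) : Fin 3 → F :=
  if h : (i : ℕ) < q then ![1, e ⟨i, h⟩, e ⟨i, h⟩ ^ 2] else ![0, 0, 1]

/-- Vandermonde: three finite points give the product of the differences of their parameters; if one
is the point at infinity, a single difference remains up to sign. -/
theorem det_conicPoint_ne_zero {e : Fin q → F} (he : Function.Injective e) {h i k : Fin (q + 1)}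
    (hhi : h ≠ i) (hhk : h ≠ k) (hik : i ≠ k) :
    (Matrix.of ![conicPoint e h, conicPoint e i, conicPoint e k]).det ≠ 0 := by
  have hsub : ∀ {x y : Fin (q + 1)} (hx : (x : ℕ) < q) (hy : (y : ℕ) < q), x ≠ y →
      e ⟨x, hx⟩ - e ⟨y, hy⟩ ≠ 0 := by
    intro x y hx hy hxy
    rw [sub_ne_zero]
    intro h
    exact hxy (Fin.ext (Fin.mk.inj (he h)))
  have hlast : ∀ {x y : Fin (q + 1)}, ¬ (x : ℕ) < q → ¬ (y : ℕ) < q → x = y := by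
    intro x y hx hy
    ext
    omega
  rw [Matrix.det_fin_three]
  by_cases h1 : (h : ℕ) < q <;> by_cases h2 : (i : ℕ) < q <;> by_cases h3 : (k : ℕ) < q
  · simp only [conicPoint, h1, h2, h3, dif_pos, Matrix.of_apply, Matrix.cons_val]
    have := mul_ne_zero (mul_ne_zero (hsub h2 h1 hhi.symm) (hsub h3 h1 hhk.symm))
      (hsub h3 h2 hik.symm)
    convert this using 1
    ring
  · simp only [conicPoint, h1, h2, h3, dif_pos, dif_neg, not_false_eq_true, Matrix.of_apply,
      Matrix.cons_val]
    convert hsub h2 h1 hhi.symm using 1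
    ring
  · simp only [conicPoint, h1, h2, h3, dif_pos, dif_neg, not_false_eq_true, Matrix.of_apply,
      Matrix.cons_val]
    convert hsub h1 h3 hhk using 1
    ring
  · exact absurd (hlast h2 h3) hik
  · simp only [conicPoint, h1, h2, h3, dif_pos, dif_neg, not_false_eq_true, Matrix.of_apply,
      Matrix.cons_val]
    convert hsub h3 h2 hik.symm using 1
    ring
  · exact absurd (hlast h1 h3) hhk
  · exact absurd (hlast h1 h2) hhi
  · exact absurd (hlast h1 h2) hhi

/-- A vector whose scalar product with the given point of the conic is one. -/
def conicDual (q : ℕ) (F : Type) [Field F] (i : Fin (q + 1)) : Fin 3 → F :=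
  if (i : ℕ) < q then ![1, 0, 0] else ![0, 0, 1]

/-- The linear form given by the scalar product with a point of the conic. -/
def conicForm (e : Fin q → F) (i : Fin (q + 1)) : (Fin 3 → F) →ₗ[F] F :=
  dotProductBilin F F (conicPoint e i)

theorem conicForm_apply (e : Fin q → F) (i : Fin (q + 1)) (x : Fin 3 → F) :
    conicForm e i x = conicPoint e i ⬝ᵥ x := rfl

theorem conicForm_conicDual (e : Fin q → F) (i : Fin (q + 1)) :
    conicForm e i (conicDual q F i) = 1 := by
  rw [conicForm_apply, conicPoint, conicDual]
  split_ifs <;> simp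

/-- The planes on which the conic forms are constant. -/
def conicPlane (e : Fin q → F) (i : Fin (q + 1)) (j : Fin q) : AffineSubspace F (Fin 3 → F) :=
  AffineSubspace.mk' (e j • conicDual q F i) (LinearMap.ker (conicForm e i))

theorem mem_conicPlane {e : Fin q → F} {i : Fin (q + 1)} {j : Fin q} {x : Fin 3 → F} :
    x ∈ conicPlane e i j ↔ conicPoint e i ⬝ᵥ x = e j := by
  rw [conicPlane, AffineSubspace.mem_mk', LinearMap.mem_ker, vsub_eq_sub, map_sub, map_smul,
    conicForm_conicDual, smul_eq_mul, mul_one, sub_eq_zero, conicForm_apply]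

/-- Three distinct conic forms are coordinates on the space, so prescribing three values fixes one
point and prescribing two leaves one free parameter. -/
theorem exists_conicPoint_inverse {e : Fin q → F} (he : Function.Injective e)
    {h i k : Fin (q + 1)} (hhi : h ≠ i) (hhk : h ≠ k) (hik : i ≠ k) :
    ∃ N : Matrix (Fin 3) (Fin 3) F, Function.Injective N.mulVec ∧ ∀ x a b c,
      conicPoint e h ⬝ᵥ x = a ∧ conicPoint e i ⬝ᵥ x = b ∧ conicPoint e k ⬝ᵥ x = c ↔
        x = N.mulVec ![a, b, c] := by
  have hdet := (det_conicPoint_ne_zero he hhi hhk hik).isUnit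
  set M := Matrix.of ![conicPoint e h, conicPoint e i, conicPoint e k] with hM
  refine ⟨M⁻¹, Matrix.mulVec_injective_of_isUnit ?_, fun x a b c => ?_⟩
  · rw [Matrix.isUnit_nonsing_inv_iff, Matrix.isUnit_iff_isUnit_det]
    exact hdet
  · have hx : M.mulVec x = ![a, b, c] ↔ x = M⁻¹.mulVec ![a, b, c] := by
      constructor
      · intro h
        rw [← h, Matrix.mulVec_mulVec, Matrix.nonsing_inv_mul M hdet, Matrix.one_mulVec]
      · intro h
        rw [h, Matrix.mulVec_mulVec, Matrix.mul_nonsing_inv M hdet, Matrix.one_mulVec]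
    rw [← hx, funext_iff, Fin.forall_fin_succ, Fin.forall_fin_succ, Fin.forall_fin_one]
    rfl

/-- The parallel classes of planes dual to the points of a conic. -/
def conicParallelClasses [Fintype F] (hF : Fintype.card F = q) (e : Fin q ≃ F) :
    ParallelClasses q F where
  plane := conicPlane e
  finrank_direction i j := by
    rw [conicPlane, AffineSubspace.direction_mk']
    have h := Module.Dual.finrank_ker_add_one_of_ne_zero (f := conicForm e i) (by
      intro h
      have h1 := conicForm_conicDual e i
      rw [h, LinearMap.zero_apply] at h1
      exact zero_ne_one h1)
    rw [Module.finrank_fin_fun] at h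
    omega
  disjoint i j j' hj := by
    rw [Set.disjoint_left]
    intro x hx hx'
    exact hj (e.injective ((mem_conicPlane.1 hx).symm.trans (mem_conicPlane.1 hx')))
  ncard_inter i i' hi j j' := by
    have hq : 1 < q := hF ▸ Fintype.one_lt_card
    -- A third class, available since q + 1 > 2, parametrises the intersection by the value of its
    -- form.
    obtain ⟨k, hk⟩ : ∃ k, k ∉ ({i, i'} : Finset (Fin (q + 1))) := by
      by_contra! hall
      have := Finset.card_le_card (fun k _ => hall k : Finset.univ ⊆ {i, i'})
      rw [Finset.card_pair hi, Finset.card_univ, Fintype.card_fin] at this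
      omega
    simp only [Finset.mem_insert, Finset.mem_singleton, not_or] at hk
    obtain ⟨N, hN, hx⟩ := exists_conicPoint_inverse e.injective hi (Ne.symm hk.1) (Ne.symm hk.2)
    have hset : ((conicPlane e i j : Set (Fin 3 → F)) ∩ conicPlane e i' j') =
        (fun c => N.mulVec ![e j, e j', c]) '' Set.univ := by
      ext x
      simp only [Set.mem_inter_iff, SetLike.mem_coe, mem_conicPlane, Set.image_univ, Set.mem_range]
      constructor
      · rintro ⟨h1, h2⟩
        exact ⟨_, ((hx x _ _ _).1 ⟨h1, h2, rfl⟩).symm⟩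
      · rintro ⟨c, hc⟩
        have := (hx x _ _ _).2 hc.symm
        exact ⟨this.1, this.2.1⟩
    rw [hset, Set.ncard_image_of_injective, Set.ncard_univ, Nat.card_eq_fintype_card, hF]
    intro c c' hc
    exact congrFun (hN hc) 2
  ncard_inter_inter h i k hhi hik a b c := by
    obtain ⟨N, hN, hx⟩ := exists_conicPoint_inverse e.injective hhi.ne (hhi.trans hik).ne hik.ne
    rw [Set.ncard_eq_one]
    refine ⟨N.mulVec ![e a, e b, e c], ?_⟩
    ext x
    simp only [Set.mem_inter_iff, SetLike.mem_coe, mem_conicPlane, Set.mem_singleton_iff, and_assoc]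
    exact hx x _ _ _

end Conic

/-! ### Infinitely many orders and the conclusion -/

theorem IsPrimePow.exists_field {q : ℕ} (hq : IsPrimePow q) :
    ∃ (F : Type) (_ : Field F) (_ : Fintype F), Fintype.card F = q := by
  obtain ⟨p, k, hp, hk, rfl⟩ := (isPrimePow_nat_iff q).1 hq
  have : Fact p.Prime := ⟨hp⟩
  classical
  have := Fintype.ofFinite (GaloisField p k)
  exact ⟨GaloisField p k, inferInstance, inferInstance, by
    rw [← Nat.card_eq_fintype_card, GaloisField.card p k hk.ne']⟩

theorem infinite_orders {q : ℕ} (hq : IsPrimePow q) :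
    {n : ℕ | 2 ≤ n ∧ Nonempty (TwistedLatinSquareDatum q n) ∧
      Nonempty (OrthogonalArray (q * n) (q + 1))}.Infinite := by
  have hq2 : 2 ≤ q := hq.two_le
  have hinj : Function.Injective fun k : ℕ => q ^ (k + 2) := fun a b h => by
    have := Nat.pow_right_injective hq2 h
    omega
  -- Take n = q^(k+2): both n and qn are prime powers, and both are at least q² ≥ q + 1, enough
  -- slopes for q + 1 rows.
  refine Set.infinite_of_injective_forall_mem hinj fun k => ?_
  have hOA : ∀ m : ℕ, Nonempty (OrthogonalArray (q ^ (m + 2)) (q + 1)) := by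
    intro m
    obtain ⟨K, _, _, hK⟩ := (hq.pow (Nat.succ_ne_zero (m + 1))).exists_field
    refine nonempty_orthogonalArray_of_field K hK ?_
    calc q + 1 ≤ q ^ 2 := by nlinarith
      _ ≤ q ^ (m + 2) := Nat.pow_le_pow_right (by omega) (by omega)
  refine ⟨?_, ?_, ?_⟩
  · calc 2 ≤ q ^ 1 := by rwa [pow_one]
      _ ≤ q ^ (k + 2) := Nat.pow_le_pow_right (by omega) (by omega)
  · obtain ⟨F, _, _, hF⟩ := hq.exists_field
    obtain ⟨O⟩ := hOA k
    exact ⟨{ F := F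
             card_eq := hF
             classes := conicParallelClasses hF (Fintype.equivFinOfCardEq hF).symm
             -- Repeating every row of an orthogonal array q times yields the group-divisible array.
             array := ⟨fun i _ => O.row i, fun i i' hi _ _ => O.orthogonal i i' hi⟩ }⟩
  · have := hOA (k + 1)
    rwa [show q ^ (k + 1 + 2) = q * q ^ (k + 2) by ring] at this

theorem mainTheorem2 (q s : ℕ) (hq : IsPrimePow q) (hs : 2 ≤ s) (hqs : q ∣ s) :
    {n : ℕ | 2 ≤ n ∧ Nonempty (TwistedLatinSquareDatum q n) ∧
      Nonempty (OrthogonalArray (q * n) (q + 1))}.Infinite ∧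
    ∀ n : ℕ, 2 ≤ n → ∀ T : TwistedLatinSquareDatum q n,
      IsCoEdgeRegular (cliqueExtension (s / q) T.graph) ∧
      3 ≤ level (cliqueExtension (s / q) T.graph) ∧
      (s = q → level (cliqueExtension (s / q) T.graph) = 3) ∧
      (s ≠ q → level (cliqueExtension (s / q) T.graph) = 4) ∧
      (∀ O : OrthogonalArray (q * n) (q + 1),
        Cospectral (cliqueExtension (s / q) T.graph)
          (cliqueExtension s O.latinSquareGraph)) ∧
      numDistinctEigenvalues (cliqueExtension (s / q) T.graph) = 4 := by
  refine ⟨infinite_orders hq, fun n hn T => ?_⟩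
  have hq0 : 0 < q := hq.pos
  obtain ⟨m, rfl⟩ := hqs
  have hm : 1 ≤ m := by
    rcases Nat.eq_zero_or_pos m with rfl | h
    · omega
    · exact h
  rw [Nat.mul_div_cancel_left m hq0]
  have h3 : q * m = q → level (cliqueExtension m T.graph) = 3 := by
    intro h
    obtain rfl : m = 1 := Nat.eq_of_mul_eq_mul_left hq0 (h.trans (mul_one q).symm)
    exact T.level_cliqueExtension_one hn
  have h4 : q * m ≠ q → level (cliqueExtension m T.graph) = 4 := by
    intro h
    refine T.level_cliqueExtension_of_two_le hn ?_
    by_contra hlt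
    obtain rfl : m = 1 := by omega
    exact h (mul_one q)
  refine ⟨T.isCoEdgeRegular_cliqueExtension m, ?_, h3, h4, T.cospectral_cliqueExtension,
    T.numDistinctEigenvalues_cliqueExtension hn hm⟩
  by_cases h : q * m = q
  · rw [h3 h]
  · rw [h4 h]
    norm_num
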